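/- **Theorem 3.1.** For a complete Riemannian manifold $M$ of dimension $n$ put $$w(x)=\Big\{\inf_{v\in T_xM,\ |v|=1}\big(\mathrm{Ric}(v,v)+(n-1)\big)\Big\}_-,\qquad a_-=\max(-a,0),$$ and let $$\lambda_0(M)=\inf_{\phi\in C_c^\infty(M),\ \phi\neq0}\frac{\int_M|\nabla\phi|^2}{\int_M\phi^2}$$ be the bottom of the spectrum of the Laplacian. Then for every integer $n\ge 2$ and every real $s$ with $0<s<\tfrac12$ there exists a connected complete smooth Riemannian manifold $(M,g)$ of dimension $n$ such that $$\int_M w^s<\infty\qquad\text{and}\qquad \lambda_0(M)>\frac{(n-1)^2}{4}.$$ -/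

import Mathlib

open MeasureTheory Bundle
open scoped Manifold ContDiff

namespace IntegralRicci

noncomputable section

/-! ### Curvature of a metric given in coordinates -/

section Coordinates

variable {n : ℕ}

/-- The partial derivative `∂_i f` of a function on `ℝⁿ`. -/
def partialDeriv (i : Fin n) (f : EuclideanSpace ℝ (Fin n) → ℝ) (y : EuclideanSpace ℝ (Fin n)) :
    ℝ :=
  fderiv ℝ f y (EuclideanSpace.single i 1)

/-- The Christoffel symbols
`Γ^k_{ij} = ½ ∑_l g^{kl} (∂_i g_{jl} + ∂_j g_{il} - ∂_l g_{ij})`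
of a metric `y ↦ (g_{ij}(y))` on an open part of `ℝⁿ`. -/
def christoffel (g : EuclideanSpace ℝ (Fin n) → Matrix (Fin n) (Fin n) ℝ) (k i j : Fin n)
    (y : EuclideanSpace ℝ (Fin n)) : ℝ :=
  (1 / 2) * ∑ l, (g y)⁻¹ k l *
    (partialDeriv i (fun z => g z j l) y + partialDeriv j (fun z => g z i l) y
      - partialDeriv l (fun z => g z i j) y)

/-- The components of the Ricci tensor
`R_{jk} = ∑_i ∂_i Γ^i_{jk} - ∑_i ∂_j Γ^i_{ik} + ∑_{i,l} (Γ^i_{il} Γ^l_{jk} - Γ^i_{jl} Γ^l_{ik})`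
(with the sign for which round spheres have positive Ricci curvature). -/
def ricciCoord (g : EuclideanSpace ℝ (Fin n) → Matrix (Fin n) (Fin n) ℝ) (j k : Fin n)
    (y : EuclideanSpace ℝ (Fin n)) : ℝ :=
  ∑ i, partialDeriv i (christoffel g i j k) y - ∑ i, partialDeriv j (christoffel g i i k) y
    + ∑ i, ∑ l, (christoffel g i i l y * christoffel g l j k y
      - christoffel g i j l y * christoffel g l i k y)

end Coordinates

/-! ### Riemannian manifolds -/

section Manifolds

variable (n : ℕ) {M : Type*} [TopologicalSpace M] [ChartedSpace (EuclideanSpace ℝ (Fin n)) M]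

/-- The coordinate vector field `∂/∂xⁱ` of the preferred chart at `p`, at the point with
coordinates `y` in that chart. -/
def coordVector (p : M) (i : Fin n) (y : EuclideanSpace ℝ (Fin n)) :
    TangentSpace (𝓡 n) ((extChartAt (𝓡 n) p).symm y) :=
  mfderiv (𝓡 n) (𝓡 n) (extChartAt (𝓡 n) p).symm y (EuclideanSpace.single i (1 : ℝ))

/-- The coordinates of a tangent vector `v` at `x` in the preferred chart at `x`. -/
def tangentCoord (x : M) (v : TangentSpace (𝓡 n) x) : EuclideanSpace ℝ (Fin n) :=
  mfderiv (𝓡 n) (𝓡 n) (extChartAt (𝓡 n) x) x v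

/-- The differential of a real function, as a linear form on the tangent space. -/
def differential (φ : M → ℝ) (x : M) : TangentSpace (𝓡 n) x →L[ℝ] ℝ :=
  mfderiv (𝓡 n) 𝓘(ℝ, ℝ) φ x

variable [RiemannianBundle (fun x : M => TangentSpace (𝓡 n) x)]

/-- The matrix `g_{ij} = ⟨∂/∂xⁱ, ∂/∂xʲ⟩` of the Riemannian metric in the preferred chart at `p`,
as a function of the coordinates. -/
def metricCoord (p : M) (y : EuclideanSpace ℝ (Fin n)) : Matrix (Fin n) (Fin n) ℝ :=
  Matrix.of fun i j => inner ℝ (coordVector n p i y) (coordVector n p j y)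

/-- The Ricci curvature `Ric(v, v')` for tangent vectors at `x`, computed in the preferred chart
at `x`. -/
def ricci (x : M) (v v' : TangentSpace (𝓡 n) x) : ℝ :=
  ∑ j, ∑ k, ricciCoord (metricCoord n x) j k (extChartAt (𝓡 n) x x)
    * tangentCoord n x v j * tangentCoord n x v' k

/-- The function `w = {inf_{|v| = 1} (Ric(v, v) + (n - 1))}₋`, where `a₋ = max (-a) 0`. -/
def ricciDefect (x : M) : ℝ :=
  max (-(⨅ v : {v : TangentSpace (𝓡 n) x // ‖v‖ = 1}, (ricci n x v.1 v.1 + ((n : ℝ) - 1)))) 0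

/-- The norm `|∇φ|(x)` of the gradient, that is, the norm of the differential `dφ_x` as a linear
form on the Euclidean space `T_x M`. -/
def gradNorm (φ : M → ℝ) (x : M) : ℝ :=
  ‖differential n φ x‖

variable [MeasurableSpace M]

/-- The measure `√(det g) dx¹ ⋯ dxⁿ` on the domain of the preferred chart at `p`, extended by zero
to the whole manifold. -/
def chartVolume (p : M) : Measure M :=
  (((volume : Measure (EuclideanSpace ℝ (Fin n))).restrict (extChartAt (𝓡 n) p).target).withDensity
    (fun y => ENNReal.ofReal (Real.sqrt (metricCoord n p y).det))).map (extChartAt (𝓡 n) p).symm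

variable (M) in
/-- The Riemannian volume measure. By the change of variables formula, the measures
`√(det g) dx` of two charts agree on the overlap of their domains, so that the supremum of
these measures is the measure obtained by gluing them: on the domain of each chart
it is `√(det g) dx`. -/
def riemannianVolume : Measure M :=
  ⨆ p : M, chartVolume n p

variable (M) in
/-- The bottom of the spectrum of the Laplacian,
`λ₀(M) = inf (∫ |∇φ|²) / (∫ φ²)` over the smooth functions `φ ≠ 0` with compact support. -/
def bottomSpectrum : ℝ :=
  sInf {r : ℝ | ∃ φ : M → ℝ, ContMDiff (𝓡 n) 𝓘(ℝ, ℝ) ∞ φ ∧ HasCompactSupport φ ∧ φ ≠ 0 ∧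
    r = (∫ x, gradNorm n φ x ^ 2 ∂(riemannianVolume n M)) /
      (∫ x, φ x ^ 2 ∂(riemannianVolume n M))}

end Manifolds

end

end IntegralRicci

/-! The manifold is `ℝⁿ` with a warped metric `dr² + f(r)² g_S`, where `f = r e^G` and `f'/f = 1/r +
K(r)`. The bottom of the spectrum only sees `f'/f`, while the Ricci curvature also sees `K'`: its
radial eigenvalue is `-(n-1) f''/f` and its tangential one is `-f''/f - (n-2)(f'² - 1)/f²`, with
`f''/f = K' + K² + 2K/r`. So `K` can be kept well above `1` while almost all the negative curvature
is squeezed into thin shells.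

Spectrum: the mean curvature of the spheres is `(n-1)(1/r + K)`. If it is at least `2a`, integrating
the divergence of `φ² a ∇r` and completing the square gives `λ₀ ≥ a²` (McKean's argument). Since `K
≥ 5/4` away from the origin, `a = 5(n-1)/8 > (n-1)/2` is admissible. See
`integral_sq_le_integral_gradNorm_sq` and `le_bottomSpectrum`.

Ricci: `K` is a sawtooth with values in `[5/4, 7/4]`. On its long descents the slope `-8(n-1)` makes
`-f''/f` so positive that `Ric ≥ -(n-1)` and `w = 0`. On the `k`-th steep ascent, whose width is of
order `ε k`, `w` is at most a constant times `1/ε k`, so the shell contributes at most `V k * ε k ^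
(1 - s)` to the integral of `w^s`, with `V k` independent of `ε`. As `s < 1`, a rapidly decreasing
`ε` makes the sum converge. See `ricciDefect_sawtooth_le` and `exists_lintegral_ricciDefect_lt_top`.

The curvature is computed in Cartesian coordinates. Writing everything in `t = r²/2`, whose
differential is `∑ yᵢ dyᵢ`, and making the metric flat near `0` avoids any singularity at the
origin. -/

/-! ### Smooth sections of the bundle of bilinear forms -/

lemma Bundle.hom_hom_trivializationAt_apply {B F : Type*} {E : B → Type*} [TopologicalSpace B]
    [NormedAddCommGroup F] [NormedSpace ℝ F] [TopologicalSpace (TotalSpace F E)]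
    [∀ b, TopologicalSpace (E b)] [∀ b, AddCommGroup (E b)] [∀ b, Module ℝ (E b)]
    [∀ b, IsTopologicalAddGroup (E b)] [∀ b, ContinuousConstSMul ℝ (E b)]
    [FiberBundle F E] [VectorBundle ℝ F E] (x y : B)
    (hy : y ∈ (trivializationAt F E x).baseSet) (φ : E y →L[ℝ] E y →L[ℝ] ℝ) (v w : F) :
    (trivializationAt (F →L[ℝ] F →L[ℝ] ℝ) (fun b => E b →L[ℝ] E b →L[ℝ] ℝ) x ⟨y, φ⟩).2 v w
      = φ ((trivializationAt F E x).symmL ℝ y v) ((trivializationAt F E x).symmL ℝ y w) := by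
  rw [hom_trivializationAt_apply]
  have : y ∈ (trivializationAt (F →L[ℝ] ℝ) (fun x ↦ E x →L[ℝ] ℝ) x).baseSet := by simp [hy]
  simp [Trivialization.linearMapAt_apply, hy, hom_trivializationAt_apply,
    ContinuousLinearMap.inCoordinates]

/-- A smooth family of bilinear forms on a vector space is a smooth section. -/
lemma contMDiff_bilinSection_of_contDiff {E : Type*} [NormedAddCommGroup E] [NormedSpace ℝ E]
    (g : E → E →L[ℝ] E →L[ℝ] ℝ) (hg : ContDiff ℝ ∞ g) :
    ContMDiff 𝓘(ℝ, E) (𝓘(ℝ, E).prod 𝓘(ℝ, E →L[ℝ] E →L[ℝ] ℝ)) ∞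
      (fun b : E ↦ TotalSpace.mk' (E →L[ℝ] E →L[ℝ] ℝ)
        (E := fun b : E => TangentSpace 𝓘(ℝ, E) b →L[ℝ] TangentSpace 𝓘(ℝ, E) b →L[ℝ] ℝ) b
          (g b)) := by
  intro x
  refine (contMDiffAt_section x).2 ?_
  refine (contMDiff_iff_contDiff.2 hg).contMDiffAt.congr_of_eventuallyEq
    (Filter.Eventually.of_forall fun y => ?_)
  ext v w
  refine (Bundle.hom_hom_trivializationAt_apply x y (by simp [chartAt_self_eq]) _ v w).trans ?_
  have := TangentBundle.symmL_model_space (𝕜 := ℝ) (F := E) x y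
  exact congrArg₂ (fun a b => g y a b) congr($this v) congr($this w)

/-! ### Rotationally symmetric metrics on `ℝⁿ` -/

/-- The data of a rotationally symmetric metric `dr² + r² e^{2G(r²/2)} g_{S}` on `ℝⁿ` which is flat
near the origin. -/
structure RadialProfile where
  /-- The logarithmic warping factor, as a function of `r² / 2`. -/
  G : ℝ → ℝ
  contDiff : ContDiff ℝ ∞ G
  /-- The profile is flat for `r² / 2 ≤ c`. -/
  c : ℝ
  c_pos : 0 < c
  eq_zero : ∀ t ≤ c, G t = 0
  nonneg : ∀ t, 0 ≤ G t

namespace RadialProfile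

noncomputable section

variable (P : RadialProfile) {n : ℕ}

/-- The tangential coefficient of the metric. -/
def A (t : ℝ) : ℝ := Real.exp (2 * P.G t)

/-- The coefficient of `x ⊗ x` in the metric. -/
def B (t : ℝ) : ℝ := (1 - P.A t) / (2 * t)

lemma A_pos (t : ℝ) : 0 < P.A t := Real.exp_pos _

lemma one_le_A (t : ℝ) : 1 ≤ P.A t := Real.one_le_exp (by linarith [P.nonneg t])

lemma A_eq_one {t : ℝ} (ht : t ≤ P.c) : P.A t = 1 := by simp [A, P.eq_zero t ht]

lemma B_eq_zero {t : ℝ} (ht : t ≤ P.c) : P.B t = 0 := by simp [B, P.A_eq_one ht]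

/-- This normalisation says that the radial direction has unit length: `1` is the radial eigenvalue
of the metric and `A` the tangential one. -/
lemma A_add_B (t : ℝ) : P.A t + 2 * t * P.B t = 1 := by
  rcases eq_or_ne t 0 with rfl | ht
  · simp [P.A_eq_one P.c_pos.le]
  · rw [B]; field_simp; ring

lemma B_nonpos {t : ℝ} (ht : 0 ≤ t) : P.B t ≤ 0 :=
  div_nonpos_of_nonpos_of_nonneg (by linarith [P.one_le_A t]) (by linarith)

lemma contDiff_A : ContDiff ℝ ∞ P.A :=
  Real.contDiff_exp.comp (contDiff_const.mul P.contDiff)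

/-- The quotient is singular only at `t = 0`, and flatness for `t ≤ c` makes `B` vanish around that
point. -/
lemma contDiff_B : ContDiff ℝ ∞ P.B := by
  rw [contDiff_iff_contDiffAt]
  intro t
  rcases lt_or_ge t P.c with h | h
  · refine (contDiffAt_const (c := (0 : ℝ))).congr_of_eventuallyEq ?_
    filter_upwards [Iio_mem_nhds h] with u hu using P.B_eq_zero (le_of_lt hu)
  · have : (2 * t) ≠ 0 := by linarith [P.c_pos]
    exact (contDiffAt_const.sub P.contDiff_A.contDiffAt).div
      (contDiffAt_const.mul contDiffAt_id) this

variable (n) in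
/-- The Euclidean scalar product as a continuous bilinear form. -/
def euclideanForm :
    EuclideanSpace ℝ (Fin n) →L[ℝ] EuclideanSpace ℝ (Fin n) →L[ℝ] ℝ :=
  innerSL ℝ

/-- The bilinear form of the metric at `x`. -/
def form (x : EuclideanSpace ℝ (Fin n)) :
    EuclideanSpace ℝ (Fin n) →L[ℝ] EuclideanSpace ℝ (Fin n) →L[ℝ] ℝ :=
  P.A (‖x‖ ^ 2 / 2) • euclideanForm n +  P.B (‖x‖ ^ 2 / 2) • (euclideanForm n x).smulRight (euclideanForm n x)

lemma form_apply (x v w : EuclideanSpace ℝ (Fin n)) :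
    P.form x v w = P.A (‖x‖ ^ 2 / 2) * inner ℝ v w
      + P.B (‖x‖ ^ 2 / 2) * (inner ℝ x v * inner ℝ x w) := by
  rfl

/-- The eigenvalues `1` and `A ≥ 1` make the metric dominate the Euclidean one; positivity and
completeness both rest on this. -/
lemma le_form_self (x v : EuclideanSpace ℝ (Fin n)) : ‖v‖ ^ 2 ≤ P.form x v v := by
  rw [form_apply, real_inner_self_eq_norm_sq]
  have h1 := P.A_add_B (‖x‖ ^ 2 / 2)
  have h2 := P.B_nonpos (t := ‖x‖ ^ 2 / 2) (by positivity)
  have h3 : inner ℝ x v * inner ℝ x v ≤ ‖x‖ ^ 2 * ‖v‖ ^ 2 := by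
    have := real_inner_mul_inner_self_le x v
    simpa [real_inner_self_eq_norm_sq] using this
  have h4 := mul_le_mul_of_nonpos_left h3 h2
  have h5 : P.A (‖x‖ ^ 2 / 2) * ‖v‖ ^ 2 + P.B (‖x‖ ^ 2 / 2) * (‖x‖ ^ 2 * ‖v‖ ^ 2)
      = (P.A (‖x‖ ^ 2 / 2) + 2 * (‖x‖ ^ 2 / 2) * P.B (‖x‖ ^ 2 / 2)) * ‖v‖ ^ 2 := by ring
  rw [h1] at h5
  linarith

lemma _root_.ContDiff.real_smul {E F : Type*} [NormedAddCommGroup E] [NormedSpace ℝ E]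
    [NormedAddCommGroup F] [NormedSpace ℝ F] {a : E → ℝ} {f : E → F} {m : WithTop ℕ∞}
    (ha : ContDiff ℝ m a) (hf : ContDiff ℝ m f) : ContDiff ℝ m fun x => a x • f x :=
  ha.smul hf

lemma contDiff_form : ContDiff ℝ ∞ (P.form (n := n)) := by
  have h : ContDiff ℝ ∞ (fun x : EuclideanSpace ℝ (Fin n) => ‖x‖ ^ 2 / 2) :=
    (contDiff_norm_sq ℝ).div_const _
  exact ((P.contDiff_A.comp h).real_smul contDiff_const).add ((P.contDiff_B.comp h).real_smul
    ((euclideanForm n).contDiff.smulRight (euclideanForm n).contDiff))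

/-- The space `ℝⁿ`, to be endowed with the metric of the profile `P`. -/
def Space (_ : RadialProfile) (n : ℕ) : Type := EuclideanSpace ℝ (Fin n)

/-- The identity map from `ℝⁿ`. -/
def toSpace : EuclideanSpace ℝ (Fin n) ≃ P.Space n := Equiv.refl _

instance : TopologicalSpace (P.Space n) :=
  inferInstanceAs (TopologicalSpace (EuclideanSpace ℝ (Fin n)))

instance : ChartedSpace (EuclideanSpace ℝ (Fin n)) (P.Space n) :=
  inferInstanceAs (ChartedSpace (EuclideanSpace ℝ (Fin n)) (EuclideanSpace ℝ (Fin n)))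

instance : IsManifold (𝓡 n) ∞ (P.Space n) :=
  inferInstanceAs (IsManifold (𝓡 n) ∞ (EuclideanSpace ℝ (Fin n)))

instance : IsManifold (𝓡 n) 1 (P.Space n) :=
  inferInstanceAs (IsManifold (𝓡 n) 1 (EuclideanSpace ℝ (Fin n)))

instance : T3Space (P.Space n) := inferInstanceAs (T3Space (EuclideanSpace ℝ (Fin n)))

instance : SecondCountableTopology (P.Space n) :=
  inferInstanceAs (SecondCountableTopology (EuclideanSpace ℝ (Fin n)))

instance : ConnectedSpace (P.Space n) :=
  inferInstanceAs (ConnectedSpace (EuclideanSpace ℝ (Fin n)))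

instance : MeasurableSpace (P.Space n) :=
  inferInstanceAs (MeasurableSpace (EuclideanSpace ℝ (Fin n)))

instance : BorelSpace (P.Space n) :=
  inferInstanceAs (BorelSpace (EuclideanSpace ℝ (Fin n)))

lemma isVonNBounded_form (x : EuclideanSpace ℝ (Fin n)) :
    Bornology.IsVonNBounded ℝ {v : EuclideanSpace ℝ (Fin n) | P.form x v v < 1} := by
  refine (NormedSpace.isVonNBounded_ball ℝ (EuclideanSpace ℝ (Fin n)) 1).subset fun v hv => ?_
  have := P.le_form_self x v
  have hv : P.form x v v < 1 := hv
  rw [mem_ball_zero_iff]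
  nlinarith [norm_nonneg v]

lemma form_symm (x v w : EuclideanSpace ℝ (Fin n)) : P.form x v w = P.form x w v := by
  rw [form_apply, form_apply, real_inner_comm, mul_comm (inner ℝ x v)]

lemma form_self_pos (x v : EuclideanSpace ℝ (Fin n)) (hv : v ≠ 0) : 0 < P.form x v v :=
  lt_of_lt_of_le (by positivity) (P.le_form_self x v)

variable (n) in
/-- The metric of the profile `P`, as a smooth Riemannian metric. -/
def metric : ContMDiffRiemannianMetric (𝓡 n) ∞ (EuclideanSpace ℝ (Fin n))
    (fun x : P.Space n => TangentSpace (𝓡 n) x) where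
  inner x := P.form (n := n) x
  symm x := P.form_symm (n := n) x
  pos x := P.form_self_pos (n := n) x
  isVonNBounded x := P.isVonNBounded_form (n := n) x
  contMDiff := contMDiff_bilinSection_of_contDiff _ P.contDiff_form

instance : RiemannianBundle (fun x : P.Space n => TangentSpace (𝓡 n) x) :=
  ⟨(P.metric n).toRiemannianMetric⟩

instance : IsContMDiffRiemannianBundle (𝓡 n) ∞ (EuclideanSpace ℝ (Fin n))
    (fun x : P.Space n => TangentSpace (𝓡 n) x) :=
  inferInstance

instance : IsContinuousRiemannianBundle (EuclideanSpace ℝ (Fin n))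
    (fun x : P.Space n => TangentSpace (𝓡 n) x) :=
  ⟨(P.metric n).inner, (P.metric n).contMDiff.continuous, fun _ _ _ => rfl⟩

instance : EMetricSpace (P.Space n) := EMetricSpace.ofRiemannianMetric (𝓡 n) (P.Space n)

instance : IsRiemannianManifold (𝓡 n) (P.Space n) := ⟨fun _ _ => rfl⟩

lemma inner_eq (x : P.Space n) (v w : TangentSpace (𝓡 n) x) :
    inner ℝ v w = P.form (n := n) x v w := rfl

lemma norm_sq_eq (x : P.Space n) (v : TangentSpace (𝓡 n) x) :
    ‖v‖ ^ 2 = P.form (n := n) x v v := by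
  rw [← real_inner_self_eq_norm_sq, inner_eq]

end

end RadialProfile

namespace RadialProfile

noncomputable section

open IntegralRicci

variable (P : RadialProfile) {n : ℕ}

/-! ### Completeness -/

lemma enorm_le_enorm_tangentSpace (x : P.Space n) (w : EuclideanSpace ℝ (Fin n))
    (v : TangentSpace (𝓡 n) x) (h : w = v) : ‖w‖ₑ ≤ ‖v‖ₑ := by
  rw [← ofReal_norm w, ← ofReal_norm v]
  refine ENNReal.ofReal_le_ofReal (abs_le_of_sq_le_sq' ?_ (norm_nonneg _)).2
  rw [norm_sq_eq, h]
  exact P.le_form_self _ _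

/-- Every curve is at least as long for the metric of `P` as for the Euclidean one, by
`le_form_self`. -/
lemma edist_le_edist (x y : P.Space n) :
    edist (P.toSpace.symm x) (P.toSpace.symm y) ≤ edist x y := by
  refine le_of_forall_gt fun r hr => ?_
  have hr' : Manifold.riemannianEDist (𝓡 n) x y < r := hr
  obtain ⟨γ, h0, h1, hγ, hlt⟩ := Manifold.exists_lt_of_riemannianEDist_lt hr'
  refine lt_of_le_of_lt ?_ hlt
  let e : ℝ → EuclideanSpace ℝ (Fin n) := γ
  have he0 : e 0 = P.toSpace.symm x := h0
  have he1 : e 1 = P.toSpace.symm y := h1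
  have D : ContDiffOn ℝ 1 e (Set.Icc 0 1) := contMDiffOn_iff_contDiffOn.mp hγ
  rw [edist_comm, edist_eq_enorm_sub, ← he0, ← he1]
  refine (enorm_sub_le_lintegral_derivWithin_Icc_of_contDiffOn_Icc D zero_le_one).trans ?_
  rw [Manifold.pathELength_eq_lintegral_mfderivWithin_Icc]
  refine lintegral_mono fun t => ?_
  refine P.enorm_le_enorm_tangentSpace _ _ _ ?_
  rw [← fderivWithin_derivWithin]
  have h := mfderivWithin_eq_fderivWithin (𝕜 := ℝ) (f := e) (s := Set.Icc 0 1) (x := t)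
  exact congr($(h.symm) 1)

instance : CompleteSpace (P.Space n) := by
  refine EMetric.complete_of_cauchySeq_tendsto fun u hu => ?_
  have hu' : CauchySeq (fun k => P.toSpace.symm (u k)) := by
    rw [EMetric.cauchySeq_iff] at hu ⊢
    intro ε hε
    obtain ⟨N, hN⟩ := hu ε hε
    exact ⟨N, fun i hi j hj => (P.edist_le_edist _ _).trans_lt (hN i hi j hj)⟩
  obtain ⟨a, ha⟩ := cauchySeq_tendsto_of_complete hu'
  -- The Riemannian distance induces the original topology of `ℝⁿ`, so the Euclidean limit is also a
  -- limit here.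
  exact ⟨P.toSpace a, ha⟩

/-! ### The metric in the global chart -/

lemma extChartAt_eq (p : P.Space n) :
    extChartAt (𝓡 n) p = (PartialEquiv.refl (EuclideanSpace ℝ (Fin n)) :
      PartialEquiv (P.Space n) (EuclideanSpace ℝ (Fin n))) := by
  have := extChartAt_model_space_eq_id (𝕜 := ℝ) (E := EuclideanSpace ℝ (Fin n)) (P.toSpace.symm p)
  exact this

lemma coordVector_eq (p : P.Space n) (i : Fin n) (y : EuclideanSpace ℝ (Fin n)) :
    coordVector n p i y = (EuclideanSpace.single i (1 : ℝ) : EuclideanSpace ℝ (Fin n)) := by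
  have h : mfderiv (𝓡 n) (𝓡 n) (extChartAt (𝓡 n) p).symm y
      = ContinuousLinearMap.id ℝ (EuclideanSpace ℝ (Fin n)) := by
    rw [extChartAt_eq]
    exact mfderiv_id (I := 𝓡 n) (M := EuclideanSpace ℝ (Fin n))
  exact congr($h _)

lemma tangentCoord_eq (x : P.Space n) (v : TangentSpace (𝓡 n) x) :
    tangentCoord n x v = (v : EuclideanSpace ℝ (Fin n)) := by
  have h : mfderiv (𝓡 n) (𝓡 n) (extChartAt (𝓡 n) x) x
      = ContinuousLinearMap.id ℝ (EuclideanSpace ℝ (Fin n)) := by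
    rw [extChartAt_eq]
    exact mfderiv_id (I := 𝓡 n) (M := EuclideanSpace ℝ (Fin n))
  exact congr($h _)

variable (n) in
/-- The matrix of the metric in Cartesian coordinates. -/
def matrix (y : EuclideanSpace ℝ (Fin n)) : Matrix (Fin n) (Fin n) ℝ :=
  Matrix.of fun i j => P.A (‖y‖ ^ 2 / 2) * (if i = j then 1 else 0)
    + P.B (‖y‖ ^ 2 / 2) * (y i * y j)

lemma metricCoord_eq (p : P.Space n) : metricCoord n p = P.matrix n := by
  ext y i j
  have h : metricCoord n p y i j = P.form ((extChartAt (𝓡 n) p).symm y) (coordVector n p i y)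
    (coordVector n p j y) := rfl
  rw [h, coordVector_eq, coordVector_eq, extChartAt_eq]
  refine (P.form_apply y _ _).trans ?_
  simp [matrix, EuclideanSpace.inner_single_right, eq_comm]

/-- A scalar matrix perturbed by rank one, in the shape required by the matrix determinant lemma. -/
lemma matrix_eq (y : EuclideanSpace ℝ (Fin n)) : P.matrix n y =
    P.A (‖y‖ ^ 2 / 2) • (1 + Matrix.replicateCol Unit (fun i => P.B (‖y‖ ^ 2 / 2)
      / P.A (‖y‖ ^ 2 / 2) * y i) * Matrix.replicateRow Unit (fun i => y i)) := by
  have := (P.A_pos (‖y‖ ^ 2 / 2)).ne'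
  ext i j
  simp [matrix, Matrix.mul_apply, Matrix.one_apply]
  split_ifs
  · field_simp
  · field_simp
    ring

lemma det_matrix (hn : 1 ≤ n) (y : EuclideanSpace ℝ (Fin n)) :
    (P.matrix n y).det = Real.exp (2 * ((n - 1) * P.G (‖y‖ ^ 2 / 2))) := by
  have hA := (P.A_pos (‖y‖ ^ 2 / 2)).ne'
  have hs : ∑ i, y i * y i = 2 * (‖y‖ ^ 2 / 2) := by
    rw [EuclideanSpace.real_norm_sq_eq]
    rw [mul_div_cancel₀ _ two_ne_zero]
    exact Finset.sum_congr rfl fun i _ => (sq _).symm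
  have h1 : (1 : ℝ) + (fun i => y i) ⬝ᵥ (fun i => P.B (‖y‖ ^ 2 / 2) / P.A (‖y‖ ^ 2 / 2) * y i)
      = (P.A (‖y‖ ^ 2 / 2))⁻¹ := by
    have h2 : (fun i => y i) ⬝ᵥ (fun i => P.B (‖y‖ ^ 2 / 2) / P.A (‖y‖ ^ 2 / 2) * y i)
      = P.B (‖y‖ ^ 2 / 2) / P.A (‖y‖ ^ 2 / 2) * (2 * (‖y‖ ^ 2 / 2)) := by
      rw [← hs, Finset.mul_sum, dotProduct]
      exact Finset.sum_congr rfl fun i _ => by ring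
    rw [h2]
    have := P.A_add_B (‖y‖ ^ 2 / 2)
    field_simp
    linarith
  rw [matrix_eq, Matrix.det_smul, Matrix.det_one_add_replicateCol_mul_replicateRow, h1,
    Fintype.card_fin]
  obtain ⟨m, rfl⟩ : ∃ m, n = m + 1 := ⟨n - 1, by omega⟩
  rw [pow_succ, mul_assoc, mul_inv_cancel₀ hA, mul_one, A, ← Real.exp_nat_mul]
  push_cast
  ring_nf

lemma sqrt_det_matrix (hn : 1 ≤ n) (y : EuclideanSpace ℝ (Fin n)) :
    √(P.matrix n y).det = Real.exp ((n - 1) * P.G (‖y‖ ^ 2 / 2)) := by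
  rw [P.det_matrix hn, two_mul, Real.exp_add, Real.sqrt_mul_self (Real.exp_pos _).le]

/-! ### The Riemannian measure -/

variable (n) in
/-- The density of the Riemannian measure. -/
def density (y : EuclideanSpace ℝ (Fin n)) : ℝ := Real.exp ((n - 1) * P.G (‖y‖ ^ 2 / 2))

lemma contDiff_density : ContDiff ℝ ∞ (P.density n) :=
  Real.contDiff_exp.comp (contDiff_const.mul
    (P.contDiff.comp ((contDiff_norm_sq ℝ).div_const _)))

lemma density_pos (y : EuclideanSpace ℝ (Fin n)) : 0 < P.density n y := Real.exp_pos _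

lemma measurable_density : Measurable (P.density n) :=
  P.contDiff_density.continuous.measurable

lemma measurableEmbedding_toSpace : MeasurableEmbedding (P.toSpace (n := n)) :=
  MeasurableEmbedding.id

/-- Every preferred chart is the identity, so the supremum runs over a constant, nonempty family. -/
lemma riemannianVolume_eq (hn : 1 ≤ n) : riemannianVolume n (P.Space n) =
    (volume.withDensity fun y => ENNReal.ofReal (P.density n y)).map P.toSpace := by
  have h (p : P.Space n) : chartVolume n p =
      (volume.withDensity fun y => ENNReal.ofReal (P.density n y)).map P.toSpace := by
    unfold chartVolume
    rw [extChartAt_eq, metricCoord_eq]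
    have h1 : (PartialEquiv.refl (EuclideanSpace ℝ (Fin n))).target = Set.univ := rfl
    have h2 : ((PartialEquiv.refl (EuclideanSpace ℝ (Fin n))).symm :
      EuclideanSpace ℝ (Fin n) → EuclideanSpace ℝ (Fin n)) = P.toSpace := rfl
    simp_rw [P.sqrt_det_matrix hn]
    erw [h1, Measure.restrict_univ]
    rfl
  have : Nonempty (P.Space n) := ⟨P.toSpace 0⟩
  rw [riemannianVolume]
  simp_rw [h]
  exact ciSup_const

lemma lintegral_riemannianVolume (hn : 1 ≤ n) (f : P.Space n → ENNReal) :
    ∫⁻ x, f x ∂(riemannianVolume n (P.Space n)) =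
      ∫⁻ y, ENNReal.ofReal (P.density n y) * f (P.toSpace y) := by
  rw [P.riemannianVolume_eq hn, P.measurableEmbedding_toSpace.lintegral_map,
    lintegral_withDensity_eq_lintegral_mul_non_measurable₀ _
      P.measurable_density.ennreal_ofReal.aemeasurable]
  · rfl
  · exact Filter.Eventually.of_forall fun _ => ENNReal.ofReal_lt_top

lemma integral_riemannianVolume (hn : 1 ≤ n) (f : P.Space n → ℝ) :
    ∫ x, f x ∂(riemannianVolume n (P.Space n)) =
      ∫ y, P.density n y * f (P.toSpace y) := by
  rw [P.riemannianVolume_eq hn, P.measurableEmbedding_toSpace.integral_map]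
  have := integral_withDensity_eq_integral_smul (μ := (volume : Measure (EuclideanSpace ℝ (Fin n))))
    (f := fun y => (P.density n y).toNNReal) P.measurable_density.real_toNNReal
    (fun y => f (P.toSpace y))
  refine this.trans (integral_congr_ae (Filter.Eventually.of_forall fun y => ?_))
  simp [NNReal.smul_def, (P.density_pos y).le]

/-! ### The differential -/

lemma differential_eq (φ : P.Space n → ℝ) (x : EuclideanSpace ℝ (Fin n))
    (v : EuclideanSpace ℝ (Fin n)) :
    differential n φ (P.toSpace x) v = fderiv ℝ (fun y => φ (P.toSpace y)) x v := by
  have : mfderiv (𝓡 n) 𝓘(ℝ, ℝ) (fun y => φ (P.toSpace y)) x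
      = fderiv ℝ (fun y => φ (P.toSpace y)) x := mfderiv_eq_fderiv
  exact congr($this v)

end

end RadialProfile

/-! ### Partial derivatives -/

/-- `f` is differentiable at `y` with `i`-th partial derivative `d`. -/
def HasPartialDerivAt {n : ℕ} (i : Fin n) (f : EuclideanSpace ℝ (Fin n) → ℝ) (d : ℝ)
    (y : EuclideanSpace ℝ (Fin n)) : Prop :=
  ∃ L : EuclideanSpace ℝ (Fin n) →L[ℝ] ℝ, HasFDerivAt f L y ∧ L (EuclideanSpace.single i 1) = d

namespace HasPartialDerivAt

variable {n : ℕ} {i : Fin n} {f g : EuclideanSpace ℝ (Fin n) → ℝ} {d e : ℝ}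
  {y : EuclideanSpace ℝ (Fin n)}

lemma partialDeriv_eq (h : HasPartialDerivAt i f d y) : IntegralRicci.partialDeriv i f y = d := by
  obtain ⟨L, hL, rfl⟩ := h
  rw [IntegralRicci.partialDeriv, hL.fderiv]

lemma add (hf : HasPartialDerivAt i f d y) (hg : HasPartialDerivAt i g e y) :
    HasPartialDerivAt i (fun z => f z + g z) (d + e) y := by
  obtain ⟨L, hL, rfl⟩ := hf
  obtain ⟨L', hL', rfl⟩ := hg
  exact ⟨L + L', hL.add hL', rfl⟩

lemma mul (hf : HasPartialDerivAt i f d y) (hg : HasPartialDerivAt i g e y) :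
    HasPartialDerivAt i (fun z => f z * g z) (d * g y + f y * e) y := by
  obtain ⟨L, hL, rfl⟩ := hf
  obtain ⟨L', hL', rfl⟩ := hg
  refine ⟨_, hL.mul hL', ?_⟩
  simp only [add_apply, smul_apply, smul_eq_mul]
  ring

lemma const (a : ℝ) : HasPartialDerivAt i (fun _ => a) 0 y :=
  ⟨0, hasFDerivAt_const a y, rfl⟩

lemma coord (j : Fin n) : HasPartialDerivAt i (fun z => z j) (if i = j then 1 else 0) y := by
  refine ⟨EuclideanSpace.proj j, (EuclideanSpace.proj (𝕜 := ℝ) j).hasFDerivAt, ?_⟩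
  simp [eq_comm]

lemma radial {F : ℝ → ℝ} (hF : DifferentiableAt ℝ F (‖y‖ ^ 2 / 2)) :
    HasPartialDerivAt i (fun z => F (‖z‖ ^ 2 / 2)) (deriv F (‖y‖ ^ 2 / 2) * y i) y := by
  have h : HasFDerivAt (fun z : EuclideanSpace ℝ (Fin n) => ‖z‖ ^ 2 / 2)
      ((2 : ℝ)⁻¹ • (2 • innerSL ℝ y)) y := by
    simp_rw [div_eq_inv_mul]
    exact (hasStrictFDerivAt_norm_sq y).hasFDerivAt.const_mul _
  refine ⟨_, hF.hasDerivAt.comp_hasFDerivAt y h, ?_⟩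
  simp [EuclideanSpace.inner_single_right]

end HasPartialDerivAt

namespace RadialProfile

noncomputable section

open IntegralRicci

variable (P : RadialProfile) {n : ℕ}

/-! ### Christoffel symbols -/

/-- The coefficient of `y_i δ_{jk} + y_j δ_{ik}` in `Γ^k_{ij}`. -/
def C (t : ℝ) : ℝ := deriv P.G t

/-- The coefficient of `δ_{ij} y_k` in `Γ^k_{ij}`. -/
def D (t : ℝ) : ℝ := P.B t - P.C t * P.A t

/-- The coefficient of `y_i y_j y_k` in `Γ^k_{ij}`. -/
def E (t : ℝ) : ℝ := deriv P.B t / 2 - 2 * P.C t * P.B t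

lemma contDiff_C : ContDiff ℝ ∞ P.C := (contDiff_infty_iff_deriv.1 P.contDiff).2

lemma contDiff_D : ContDiff ℝ ∞ P.D := P.contDiff_B.sub (P.contDiff_C.mul P.contDiff_A)

lemma contDiff_E : ContDiff ℝ ∞ P.E :=
  ((contDiff_infty_iff_deriv.1 P.contDiff_B).2.div_const _).sub
    ((contDiff_const.mul P.contDiff_C).mul P.contDiff_B)

lemma differentiable_A : Differentiable ℝ P.A := P.contDiff_A.differentiable (by simp)
lemma differentiable_B : Differentiable ℝ P.B := P.contDiff_B.differentiable (by simp)
lemma differentiable_C : Differentiable ℝ P.C := P.contDiff_C.differentiable (by simp)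
lemma differentiable_D : Differentiable ℝ P.D := P.contDiff_D.differentiable (by simp)
lemma differentiable_E : Differentiable ℝ P.E := P.contDiff_E.differentiable (by simp)

lemma deriv_A (t : ℝ) : deriv P.A t = 2 * P.C t * P.A t := by
  have h : HasDerivAt P.G (P.C t) t :=
    (P.contDiff.differentiable (by simp) t).hasDerivAt
  have := (h.const_mul 2).exp
  rw [show P.A = fun t => Real.exp (2 * P.G t) from rfl, this.deriv]
  ring

lemma deriv_B (t : ℝ) : deriv P.A t + 2 * P.B t + 2 * t * deriv P.B t = 0 := by
  have h := ((P.differentiable_A t).hasDerivAt.add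
    (((hasDerivAt_id t).const_mul 2).mul (P.differentiable_B t).hasDerivAt))
  have h2 : (P.A + (fun y => 2 * id y) * P.B) = fun _ => (1 : ℝ) := by
    funext u
    exact P.A_add_B u
  rw [h2] at h
  have := h.unique (hasDerivAt_const t (1 : ℝ))
  simp at this
  linarith

/-- This eliminates `E` from traces: `∑ᵢ Γ^i_{ik} = ((n+1) C + D + 2tE) y_k` becomes `(n-1) C y_k`,
the logarithmic derivative of the density. -/
lemma D_add_E (t : ℝ) : P.D t + 2 * t * P.E t = -2 * P.C t := by
  have h1 := P.deriv_A t
  have h2 := P.deriv_B t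
  have h3 := P.A_add_B t
  rw [D, E]
  linear_combination h2 / 2 - h1 / 2 - 2 * P.C t * h3

lemma deriv_D_add_E (t : ℝ) :
    deriv P.D t + 2 * P.E t + 2 * t * deriv P.E t = -2 * deriv P.C t := by
  have h := ((P.differentiable_D t).hasDerivAt.add
    (((hasDerivAt_id t).const_mul 2).mul (P.differentiable_E t).hasDerivAt))
  have h2 : (P.D + (fun y => 2 * id y) * P.E) = fun u => -2 * P.C u := by
    funext u
    exact P.D_add_E u
  rw [h2] at h
  have := h.unique ((P.differentiable_C t).hasDerivAt.const_mul (-2))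
  simp at this
  linarith

lemma deriv_D (t : ℝ) : deriv P.D t
    = deriv P.B t - deriv P.C t * P.A t - 2 * P.C t ^ 2 * P.A t := by
  have h := ((P.differentiable_B t).hasDerivAt.sub
    ((P.differentiable_C t).hasDerivAt.mul (P.differentiable_A t).hasDerivAt)).deriv
  rw [P.deriv_A] at h
  have : P.D = P.B - P.C * P.A := rfl
  rw [this, h]
  ring

lemma sum_mul_self (y : EuclideanSpace ℝ (Fin n)) : ∑ i, y i * y i = 2 * (‖y‖ ^ 2 / 2) := by
  rw [EuclideanSpace.real_norm_sq_eq, mul_div_cancel₀ _ two_ne_zero]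
  exact Finset.sum_congr rfl fun i _ => (sq _).symm

/-- The Sherman–Morrison formula, whose denominator `A + 2tB` equals `1`. -/
lemma matrix_inv_apply (y : EuclideanSpace ℝ (Fin n)) (k l : Fin n) :
    (P.matrix n y)⁻¹ k l = (P.A (‖y‖ ^ 2 / 2))⁻¹ *
      ((if k = l then 1 else 0) - P.B (‖y‖ ^ 2 / 2) * y k * y l) := by
  have hA := (P.A_pos (‖y‖ ^ 2 / 2)).ne'
  have hs := sum_mul_self y
  have hAB := P.A_add_B (‖y‖ ^ 2 / 2)
  have key : P.matrix n y * Matrix.of (fun k l => (P.A (‖y‖ ^ 2 / 2))⁻¹ *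
      ((if k = l then 1 else 0) - P.B (‖y‖ ^ 2 / 2) * y k * y l)) = 1 := by
    ext i j
    simp only [matrix, Matrix.mul_apply, Matrix.of_apply, Matrix.one_apply]
    set t := ‖y‖ ^ 2 / 2
    have h : ∀ l, (P.A t * (if i = l then 1 else 0) + P.B t * (y i * y l)) *
        ((P.A t)⁻¹ * ((if l = j then 1 else 0) - P.B t * y l * y j)) =
        (if i = l then (if l = j then 1 else 0) - P.B t * y l * y j else 0)
        + (P.A t)⁻¹ * P.B t * y i * (if l = j then y l else 0)
        - (P.A t)⁻¹ * P.B t ^ 2 * y i * y j * (y l * y l) := by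
      intro l
      split_ifs <;> field_simp <;> ring
    simp_rw [h, Finset.sum_sub_distrib, Finset.sum_add_distrib, ← Finset.mul_sum, hs]
    simp only [Finset.sum_ite_eq, Finset.sum_ite_eq', Finset.mem_univ, if_true]
    have : (2 * t * P.B t) = 1 - P.A t := by linarith
    split_ifs
    · field_simp
      linear_combination (-(P.B t * y i * y j)) * this
    · field_simp
      linear_combination (-(P.B t * y i * y j)) * this
  rw [Matrix.inv_eq_right_inv key]
  rfl

lemma hasPartialDerivAt_matrix (y : EuclideanSpace ℝ (Fin n)) (i j l : Fin n) :
    HasPartialDerivAt i (fun z => P.matrix n z j l)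
      (deriv P.A (‖y‖ ^ 2 / 2) * y i * (if j = l then 1 else 0)
        + deriv P.B (‖y‖ ^ 2 / 2) * y i * (y j * y l)
        + P.B (‖y‖ ^ 2 / 2) * ((if i = j then 1 else 0) * y l + y j * (if i = l then 1 else 0)))
      y := by
  have h := ((HasPartialDerivAt.radial (i := i) (P.differentiable_A (‖y‖ ^ 2 / 2))).mul
    (HasPartialDerivAt.const (if j = l then 1 else 0))).add
    ((HasPartialDerivAt.radial (i := i) (P.differentiable_B (‖y‖ ^ 2 / 2))).mul
      ((HasPartialDerivAt.coord j).mul (HasPartialDerivAt.coord l)))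
  refine (congrArg (fun d => HasPartialDerivAt i (fun z => P.matrix n z j l) d y) ?_).mp h
  ring

lemma christoffel_matrix (k i j : Fin n) : christoffel (P.matrix n) k i j = fun y =>
    P.C (‖y‖ ^ 2 / 2) * (y i * (if j = k then 1 else 0) + y j * (if i = k then 1 else 0))
      + P.D (‖y‖ ^ 2 / 2) * ((if i = j then 1 else 0) * y k)
      + P.E (‖y‖ ^ 2 / 2) * (y i * y j * y k) := by
  funext y
  have hA := (P.A_pos (‖y‖ ^ 2 / 2)).ne'
  have hs := sum_mul_self y
  have hAB := P.A_add_B (‖y‖ ^ 2 / 2)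
  have hA' := P.deriv_A (‖y‖ ^ 2 / 2)
  simp only [christoffel, matrix_inv_apply, (P.hasPartialDerivAt_matrix _ _ _ _).partialDeriv_eq,
    D, E]
  set t := ‖y‖ ^ 2 / 2
  set a := deriv P.A t
  set b := deriv P.B t
  have h : ∀ l, (P.A t)⁻¹ * ((if k = l then 1 else 0) - P.B t * y k * y l) *
      (a * y i * (if j = l then 1 else 0) + b * y i * (y j * y l)
        + P.B t * ((if i = j then 1 else 0) * y l + y j * (if i = l then 1 else 0))
      + (a * y j * (if i = l then 1 else 0) + b * y j * (y i * y l)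
        + P.B t * ((if j = i then 1 else 0) * y l + y i * (if j = l then 1 else 0)))
      - (a * y l * (if i = j then 1 else 0) + b * y l * (y i * y j)
        + P.B t * ((if l = i then 1 else 0) * y j + y i * (if l = j then 1 else 0))))
      = (if k = l then (P.A t)⁻¹ * (a * y i * (if j = l then 1 else 0)
          + a * y j * (if i = l then 1 else 0) - a * y l * (if i = j then 1 else 0)
          + b * y i * y j * y l + 2 * P.B t * y l * (if i = j then 1 else 0)) else 0)
        - (if j = l then (P.A t)⁻¹ * P.B t * y k * (a * y i * y l) else 0)
        - (if i = l then (P.A t)⁻¹ * P.B t * y k * (a * y j * y l) else 0)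
        - (P.A t)⁻¹ * P.B t * y k * (b * y i * y j + 2 * P.B t * (if i = j then 1 else 0)
          - a * (if i = j then 1 else 0)) * (y l * y l) := by
    intro l
    simp only [eq_comm (a := l) (b := i), eq_comm (a := l) (b := j), eq_comm (a := j) (b := i)]
    split_ifs <;> ring
  simp_rw [h, Finset.sum_sub_distrib, ← Finset.mul_sum, hs]
  simp only [Finset.sum_ite_eq, Finset.mem_univ, if_true]
  have h2 : 2 * t * P.B t = 1 - P.A t := by linarith
  rw [hA']
  field_simp
  generalize (if j = k then (1 : ℝ) else 0) = δ₁
  generalize (if i = k then (1 : ℝ) else 0) = δ₂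
  generalize (if i = j then (1 : ℝ) else 0) = δ₃
  linear_combination (-(y k * (b * y i * y j + 2 * P.B t * δ₃ - 2 * P.C t * P.A t * δ₃))) * h2

/-! ### Ricci curvature -/

variable (n) in
/-- The coefficient of `δ_{jk}` in the Ricci tensor. -/
def ricciA (t : ℝ) : ℝ :=
  2 * P.C t + 2 * t * deriv P.D t + n * P.D t - (n - 1) * P.C t
    + 2 * t * (n - 3) * P.C t * P.D t

variable (n) in
/-- The coefficient of `y_j y_k` in the Ricci tensor. -/
def ricciB (t : ℝ) : ℝ :=
  -deriv P.D t + n * P.E t - (n - 1) * deriv P.C t - (n - 1) * P.C t * (P.C t + P.D t)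
    + 2 * P.C t * P.D t

lemma hasPartialDerivAt_christoffel (y : EuclideanSpace ℝ (Fin n)) (m k i j : Fin n) :
    HasPartialDerivAt m (christoffel (P.matrix n) k i j)
    (deriv P.C (‖y‖ ^ 2 / 2) * y m
        * (y i * (if j = k then 1 else 0) + y j * (if i = k then 1 else 0))
      + P.C (‖y‖ ^ 2 / 2) * ((if m = i then 1 else 0) * (if j = k then 1 else 0)
        + (if m = j then 1 else 0) * (if i = k then 1 else 0))
      + (deriv P.D (‖y‖ ^ 2 / 2) * y m * ((if i = j then 1 else 0) * y k)
      + P.D (‖y‖ ^ 2 / 2) * ((if i = j then 1 else 0) * (if m = k then 1 else 0)))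
      + (deriv P.E (‖y‖ ^ 2 / 2) * y m * (y i * y j * y k)
      + P.E (‖y‖ ^ 2 / 2) * (((if m = i then 1 else 0) * y j + y i * (if m = j then 1 else 0)) * y k
        + y i * y j * (if m = k then 1 else 0)))) y := by
  rw [christoffel_matrix]
  have h := (((HasPartialDerivAt.radial (i := m) (P.differentiable_C (‖y‖ ^ 2 / 2))).mul
    (((HasPartialDerivAt.coord i).mul (HasPartialDerivAt.const (if j = k then 1 else 0))).add
    ((HasPartialDerivAt.coord j).mul (HasPartialDerivAt.const (if i = k then 1 else 0))))).add
    ((HasPartialDerivAt.radial (i := m) (P.differentiable_D (‖y‖ ^ 2 / 2))).mul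
      ((HasPartialDerivAt.const (if i = j then 1 else 0)).mul (HasPartialDerivAt.coord k)))).add
    ((HasPartialDerivAt.radial (i := m) (P.differentiable_E (‖y‖ ^ 2 / 2))).mul
      (((HasPartialDerivAt.coord i).mul (HasPartialDerivAt.coord j)).mul
        (HasPartialDerivAt.coord k)))
  refine (congrArg (fun d => HasPartialDerivAt m _ d y) ?_).mp h
  ring

/-- With `X` arbitrary, one contraction serves both quadratic terms of the Ricci tensor. -/
lemma sum_christoffel_mul (y : EuclideanSpace ℝ (Fin n)) (i j : Fin n) (X : Fin n → ℝ) :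
    ∑ l, christoffel (P.matrix n) i j l y * X l =
      P.C (‖y‖ ^ 2 / 2) * y j * X i + (P.C (‖y‖ ^ 2 / 2) * (if j = i then 1 else 0)
        + P.E (‖y‖ ^ 2 / 2) * y j * y i) * ∑ l, y l * X l
        + P.D (‖y‖ ^ 2 / 2) * y i * X j := by
  simp only [christoffel_matrix]
  have h : ∀ l, (P.C (‖y‖ ^ 2 / 2) * (y j * (if l = i then 1 else 0) + y l * (if j = i then 1 else 0))
      + P.D (‖y‖ ^ 2 / 2) * ((if j = l then 1 else 0) * y i)
      + P.E (‖y‖ ^ 2 / 2) * (y j * y l * y i)) * X l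
      = (if l = i then P.C (‖y‖ ^ 2 / 2) * y j * X l else 0)
      + (P.C (‖y‖ ^ 2 / 2) * (if j = i then 1 else 0)
        + P.E (‖y‖ ^ 2 / 2) * y j * y i) * (y l * X l)
      + (if j = l then P.D (‖y‖ ^ 2 / 2) * y i * X l else 0) := by
    intro l
    split_ifs <;> ring
  simp_rw [h, Finset.sum_add_distrib, ← Finset.mul_sum]
  simp only [Finset.sum_ite_eq, Finset.sum_ite_eq', Finset.mem_univ, if_true]

lemma sum_mul_christoffel (y : EuclideanSpace ℝ (Fin n)) (j k : Fin n) :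
    ∑ l, y l * christoffel (P.matrix n) l j k y =
      (2 * P.C (‖y‖ ^ 2 / 2) + 2 * (‖y‖ ^ 2 / 2) * P.E (‖y‖ ^ 2 / 2)) * (y j * y k)
      + 2 * (‖y‖ ^ 2 / 2) * P.D (‖y‖ ^ 2 / 2) * (if j = k then 1 else 0) := by
  have hs := sum_mul_self y
  simp only [christoffel_matrix]
  set t := ‖y‖ ^ 2 / 2
  have h : ∀ l, y l * (P.C t * (y j * (if k = l then 1 else 0) + y k * (if j = l then 1 else 0))
      + P.D t * ((if j = k then 1 else 0) * y l) + P.E t * (y j * y k * y l))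
      = (if k = l then P.C t * y j * y l else 0) + (if j = l then P.C t * y k * y l else 0)
      + (P.D t * (if j = k then 1 else 0) + P.E t * (y j * y k)) * (y l * y l) := by
    intro l
    split_ifs <;> ring
  simp_rw [h, Finset.sum_add_distrib, ← Finset.mul_sum, hs]
  simp only [Finset.sum_ite_eq, Finset.mem_univ, if_true]
  ring

lemma sum_sum_christoffel_trace (y : EuclideanSpace ℝ (Fin n)) (j k : Fin n) :
    ∑ i, ∑ l, christoffel (P.matrix n) i i l y * christoffel (P.matrix n) l j k y =
      ((n + 1) * P.C (‖y‖ ^ 2 / 2) + P.D (‖y‖ ^ 2 / 2)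
        + 2 * (‖y‖ ^ 2 / 2) * P.E (‖y‖ ^ 2 / 2)) *
      ((2 * P.C (‖y‖ ^ 2 / 2) + 2 * (‖y‖ ^ 2 / 2) * P.E (‖y‖ ^ 2 / 2)) * (y j * y k)
      + 2 * (‖y‖ ^ 2 / 2) * P.D (‖y‖ ^ 2 / 2) * (if j = k then 1 else 0)) := by
  have hs := sum_mul_self y
  have hY := P.sum_mul_christoffel y j k
  simp only [P.sum_christoffel_mul y, hY, if_true, mul_one]
  rw [← hY]
  set t := ‖y‖ ^ 2 / 2
  set Y := ∑ l, y l * christoffel (P.matrix n) l j k y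
  have h : ∀ i, P.C t * y i * christoffel (P.matrix n) i j k y +
      (P.C t + P.E t * y i * y i) * Y
      + P.D t * y i * christoffel (P.matrix n) i j k y
      = (P.C t + P.D t) * (y i * christoffel (P.matrix n) i j k y)
        + P.E t * Y * (y i * y i) + P.C t * Y := by
    intro i
    ring
  simp_rw [h, Finset.sum_add_distrib, ← Finset.mul_sum, hs]
  simp only [Finset.sum_const, Finset.card_univ, Fintype.card_fin, nsmul_eq_mul]
  change (P.C t + P.D t) * Y + _ + _ = _
  ring

lemma sum_sum_christoffel_mul (y : EuclideanSpace ℝ (Fin n)) (j k : Fin n) :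
    ∑ i, ∑ l, christoffel (P.matrix n) i j l y * christoffel (P.matrix n) l i k y =
      4 * (‖y‖ ^ 2 / 2) * P.C (‖y‖ ^ 2 / 2) * P.D (‖y‖ ^ 2 / 2) * (if j = k then 1 else 0)
      + (P.C (‖y‖ ^ 2 / 2) * ((n + 1) * P.C (‖y‖ ^ 2 / 2) + P.D (‖y‖ ^ 2 / 2)
          + 2 * (‖y‖ ^ 2 / 2) * P.E (‖y‖ ^ 2 / 2))
        + P.C (‖y‖ ^ 2 / 2) * (2 * P.C (‖y‖ ^ 2 / 2) + 2 * (‖y‖ ^ 2 / 2) * P.E (‖y‖ ^ 2 / 2))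
        + P.D (‖y‖ ^ 2 / 2) * (P.C (‖y‖ ^ 2 / 2) + P.D (‖y‖ ^ 2 / 2)
          + 2 * (‖y‖ ^ 2 / 2) * P.E (‖y‖ ^ 2 / 2))
        + P.E (‖y‖ ^ 2 / 2) * (2 * (‖y‖ ^ 2 / 2)) * (2 * P.C (‖y‖ ^ 2 / 2) + P.D (‖y‖ ^ 2 / 2)
          + 2 * (‖y‖ ^ 2 / 2) * P.E (‖y‖ ^ 2 / 2))) * (y j * y k) := by
  have hs := sum_mul_self y
  simp only [P.sum_christoffel_mul y, P.sum_mul_christoffel y]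
  simp only [christoffel_matrix, if_true, mul_one]
  set t := ‖y‖ ^ 2 / 2
  set c := P.C t
  set d := P.D t
  set e := P.E t
  have h : ∀ i,
      c * y j * (c * (y i * (if k = i then 1 else 0) + y k)
        + d * ((if i = k then 1 else 0) * y i) + e * (y i * y k * y i))
      + (c * (if j = i then 1 else 0) + e * y j * y i) *
        ((2 * c + 2 * t * e) * (y i * y k) + 2 * t * d * (if i = k then 1 else 0))
      + d * y i * (c * (y i * (if k = j then 1 else 0) + y k * (if i = j then 1 else 0))
        + d * ((if i = k then 1 else 0) * y j) + e * (y i * y k * y j))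
      = (if k = i then (c * c + c * d + 2 * t * d * e + d * d) * (y j * y i)
          + 2 * t * c * d * (if j = i then 1 else 0) else 0)
        + (if j = i then (c * (2 * c + 2 * t * e) + c * d) * (y i * y k) else 0)
        + (c * e * (y j * y k) + e * (2 * c + 2 * t * e) * (y j * y k)
          + c * d * (if j = k then 1 else 0) + d * e * (y j * y k)) * (y i * y i)
        + c * c * (y j * y k) := by
    intro i
    simp only [eq_comm (a := i) (b := k), eq_comm (a := i) (b := j), eq_comm (a := k) (b := j)]
    split_ifs <;> ring
  simp_rw [h, Finset.sum_add_distrib, ← Finset.mul_sum, hs]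
  simp only [Finset.sum_ite_eq, Finset.mem_univ, if_true, Finset.sum_const, Finset.card_univ,
    Fintype.card_fin, nsmul_eq_mul]
  ring

lemma sum_partialDeriv_christoffel (y : EuclideanSpace ℝ (Fin n)) (j k : Fin n) :
    ∑ i, partialDeriv i (christoffel (P.matrix n) i j k) y =
      (2 * P.C (‖y‖ ^ 2 / 2) + 2 * (‖y‖ ^ 2 / 2) * deriv P.D (‖y‖ ^ 2 / 2)
        + n * P.D (‖y‖ ^ 2 / 2)) * (if j = k then 1 else 0)
      + (2 * deriv P.C (‖y‖ ^ 2 / 2) + 2 * (‖y‖ ^ 2 / 2) * deriv P.E (‖y‖ ^ 2 / 2)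
        + (n + 2) * P.E (‖y‖ ^ 2 / 2)) * (y j * y k) := by
  have hs := sum_mul_self y
  simp only [(P.hasPartialDerivAt_christoffel _ _ _ _ _).partialDeriv_eq, if_true, mul_one]
  set t := ‖y‖ ^ 2 / 2
  generalize deriv P.C t = c'
  generalize deriv P.D t = d'
  generalize deriv P.E t = e'
  generalize P.C t = c
  generalize P.D t = d
  generalize P.E t = e
  have h : ∀ i, c' * y i * (y j * (if k = i then 1 else 0) + y k * (if j = i then 1 else 0))
      + c * ((if i = j then 1 else 0) * (if k = i then 1 else 0)
        + (if i = k then 1 else 0) * (if j = i then 1 else 0))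
      + (d' * y i * ((if j = k then 1 else 0) * y i)
      + d * ((if j = k then 1 else 0)))
      + (e' * y i * (y j * y k * y i)
      + e * (((if i = j then 1 else 0) * y k + y j * (if i = k then 1 else 0)) * y i
        + y j * y k))
      = (if k = i then c' * (y j * y i) + c * (if j = i then 1 else 0) + e * (y j * y i) else 0)
      + (if j = i then c' * (y i * y k) + c * (if k = i then 1 else 0) + e * (y i * y k) else 0)
      + (d' * (if j = k then 1 else 0) + e' * (y j * y k)) * (y i * y i)
      + (d * (if j = k then 1 else 0) + e * (y j * y k)) := by
    intro i
    simp only [eq_comm (a := i) (b := k), eq_comm (a := i) (b := j)]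
    split_ifs <;> ring
  simp_rw [h, Finset.sum_add_distrib, ← Finset.mul_sum, hs]
  simp only [Finset.sum_ite_eq, Finset.mem_univ, if_true, Finset.sum_const, Finset.card_univ,
    Fintype.card_fin, nsmul_eq_mul, eq_comm (a := k) (b := j)]
  ring

lemma sum_partialDeriv_christoffel_trace (y : EuclideanSpace ℝ (Fin n)) (j k : Fin n) :
    ∑ i, partialDeriv j (christoffel (P.matrix n) i i k) y =
      ((n + 1) * P.C (‖y‖ ^ 2 / 2) + P.D (‖y‖ ^ 2 / 2)
        + 2 * (‖y‖ ^ 2 / 2) * P.E (‖y‖ ^ 2 / 2)) * (if j = k then 1 else 0)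
      + ((n + 1) * deriv P.C (‖y‖ ^ 2 / 2) + deriv P.D (‖y‖ ^ 2 / 2)
        + 2 * (‖y‖ ^ 2 / 2) * deriv P.E (‖y‖ ^ 2 / 2)
        + 2 * P.E (‖y‖ ^ 2 / 2)) * (y j * y k) := by
  have hs := sum_mul_self y
  simp only [(P.hasPartialDerivAt_christoffel _ _ _ _ _).partialDeriv_eq, if_true, mul_one]
  set t := ‖y‖ ^ 2 / 2
  generalize deriv P.C t = c'
  generalize deriv P.D t = d'
  generalize deriv P.E t = e'
  generalize P.C t = c
  generalize P.D t = d
  generalize P.E t = e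
  have h : ∀ i, c' * y j * (y i * (if k = i then 1 else 0) + y k)
      + c * ((if j = i then 1 else 0) * (if k = i then 1 else 0)
        + (if j = k then 1 else 0))
      + (d' * y j * ((if i = k then 1 else 0) * y i)
      + d * ((if i = k then 1 else 0) * (if j = i then 1 else 0)))
      + (e' * y j * (y i * y k * y i)
      + e * (((if j = i then 1 else 0) * y k + y i * (if j = k then 1 else 0)) * y i
        + y i * y k * (if j = i then 1 else 0)))
      = (if k = i then c' * (y j * y i) + d' * (y j * y i) + (c + d) * (if j = i then 1 else 0)
          else 0)
      + (if j = i then 2 * e * (y i * y k) else 0)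
      + (e' * (y j * y k) + e * (if j = k then 1 else 0)) * (y i * y i)
      + (c' * (y j * y k) + c * (if j = k then 1 else 0)) := by
    intro i
    simp only [eq_comm (a := i) (b := k)]
    split_ifs <;> ring
  simp_rw [h, Finset.sum_add_distrib, ← Finset.mul_sum, hs]
  simp only [Finset.sum_ite_eq, Finset.mem_univ, if_true, Finset.sum_const, Finset.card_univ,
    Fintype.card_fin, nsmul_eq_mul]
  ring

lemma ricciCoord_matrix (y : EuclideanSpace ℝ (Fin n)) (j k : Fin n) :
    ricciCoord (P.matrix n) j k y = P.ricciA n (‖y‖ ^ 2 / 2) * (if j = k then 1 else 0)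
      + P.ricciB n (‖y‖ ^ 2 / 2) * (y j * y k) := by
  have hE := P.D_add_E (‖y‖ ^ 2 / 2)
  have hE' := P.deriv_D_add_E (‖y‖ ^ 2 / 2)
  rw [ricciCoord]
  simp_rw [Finset.sum_sub_distrib]
  rw [sum_sum_christoffel_mul, sum_sum_christoffel_trace, sum_partialDeriv_christoffel_trace,
    sum_partialDeriv_christoffel, ricciA, ricciB]
  set t := ‖y‖ ^ 2 / 2
  have hE2 : 2 * t * P.E t = -2 * P.C t - P.D t := by linarith
  have hE3 : 2 * t * deriv P.E t = -2 * deriv P.C t - deriv P.D t - 2 * P.E t := by linarith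
  rw [hE2, hE3, mul_comm (P.E t) (2 * t), hE2]
  ring

end

end RadialProfile

/-! ### Eigenvalues of the Ricci tensor and bounds for the Ricci defect -/

namespace RadialProfile

noncomputable section

open IntegralRicci

variable (P : RadialProfile) {n : ℕ}

/-- The sectional curvature of the planes containing the radial direction, up to sign. -/
def radialCurv (t : ℝ) : ℝ := 3 * P.C t + 2 * t * P.C t ^ 2 + 2 * t * deriv P.C t

/-- The left side is the Ricci tensor on the unit radial vector. With `f = r e^G` and `radialCurv =
f''/f`, this is the warped-product formula `-(n-1) f''/f`. -/
lemma ricciA_add_ricciB (t : ℝ) :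
    P.ricciA n t + 2 * t * P.ricciB n t = -((n - 1) * P.radialCurv t) := by
  rw [ricciA, ricciB, radialCurv]
  linear_combination n * P.D_add_E t

/-- Since `f² = 2tA` and `f' = e^G (1 + 2tC)`, this is the tangential eigenvalue `-f''/f - (n-2)(f'²
- 1)/f²` multiplied by `f²`. -/
lemma two_mul_ricciA (t : ℝ) : 2 * t * P.ricciA n t =
    -(2 * t * P.A t * P.radialCurv t) - (n - 2) * (P.A t * (1 + 2 * t * P.C t) ^ 2 - 1) := by
  have h1 : 2 * t * P.B t = 1 - P.A t := by linarith [P.A_add_B t]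
  have h2 : 2 * t * deriv P.B t = -(2 * P.C t * P.A t) - 2 * P.B t := by
    linarith [P.deriv_A t, P.deriv_B t]
  rw [ricciA, radialCurv, P.deriv_D, D]
  linear_combination (2 * t) * h2 + (n - 2 + 2 * t * (n - 3) * P.C t) * h1

lemma ricci_self (y v : EuclideanSpace ℝ (Fin n)) :
    ricci n (P.toSpace y) v v = P.ricciA n (‖y‖ ^ 2 / 2) * ‖v‖ ^ 2
      + P.ricciB n (‖y‖ ^ 2 / 2) * (inner ℝ y v) ^ 2 := by
  have h : ricci n (P.toSpace y) v v = ∑ j, ∑ k, ricciCoord (P.matrix n) j k y * v j * v k := by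
    have hv := P.tangentCoord_eq (P.toSpace y) v
    have hy : extChartAt (𝓡 n) (P.toSpace y) (P.toSpace y) = y := by
      rw [extChartAt_eq]
      rfl
    refine Finset.sum_congr rfl fun j _ => Finset.sum_congr rfl fun k _ => ?_
    refine congrArg₂ (· * ·) (congrArg₂ (· * ·) ?_ congr($hv j)) congr($hv k)
    rw [metricCoord_eq, hy]
  rw [h]
  simp_rw [ricciCoord_matrix]
  set t := ‖y‖ ^ 2 / 2
  have h1 : inner ℝ y v = ∑ k, y k * v k := by
    simp [PiLp.inner_apply, mul_comm]
  have h2 : ‖v‖ ^ 2 = ∑ k, v k * v k := by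
    rw [EuclideanSpace.real_norm_sq_eq]
    exact Finset.sum_congr rfl fun i _ => sq _
  rw [h1, h2, sq, Finset.sum_mul_sum, Finset.mul_sum, Finset.mul_sum, ← Finset.sum_add_distrib]
  refine Finset.sum_congr rfl fun j _ => ?_
  have h3 : ∀ k, (P.ricciA n t * (if j = k then 1 else 0) + P.ricciB n t * (y j * y k)) * v j * v k
      = (if j = k then P.ricciA n t * (v j * v k) else 0)
        + P.ricciB n t * (y j * v j * (y k * v k)) := by
    intro k
    split_ifs <;> ring
  simp_rw [h3, Finset.sum_add_distrib, Finset.sum_ite_eq, Finset.mem_univ, if_true, Finset.mul_sum]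

/-- A lower bound for the Ricci curvature in terms of its two eigenvalues. -/
lemma le_ricci_self (y v : EuclideanSpace ℝ (Fin n)) (m : ℝ)
    (h1 : m ≤ -((n - 1) * P.radialCurv (‖y‖ ^ 2 / 2)))
    (h2 : m * P.A (‖y‖ ^ 2 / 2) ≤ P.ricciA n (‖y‖ ^ 2 / 2)) :
    m * P.form y v v ≤ ricci n (P.toSpace y) v v := by
  have hAB := P.A_add_B (‖y‖ ^ 2 / 2)
  have hr := P.ricciA_add_ricciB (n := n) (‖y‖ ^ 2 / 2)
  have hcs : (inner ℝ y v) ^ 2 ≤ 2 * (‖y‖ ^ 2 / 2) * ‖v‖ ^ 2 := by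
    have := real_inner_mul_inner_self_le y v
    rw [real_inner_self_eq_norm_sq, real_inner_self_eq_norm_sq] at this
    rw [sq]
    linarith
  rw [ricci_self, form_apply, real_inner_self_eq_norm_sq, ← sq (inner ℝ y v)]
  set t := ‖y‖ ^ 2 / 2
  set p := (inner ℝ y v) ^ 2
  have hp : 0 ≤ p := sq_nonneg _
  have hv : 0 ≤ ‖v‖ ^ 2 := sq_nonneg _
  have hu : 0 ≤ P.ricciA n t - m * P.A t := by linarith
  have hw : 0 ≤ (P.ricciA n t - m * P.A t) + 2 * t * (P.ricciB n t - m * P.B t) := by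
    have : (P.ricciA n t - m * P.A t) + 2 * t * (P.ricciB n t - m * P.B t)
      = (P.ricciA n t + 2 * t * P.ricciB n t) - m * (P.A t + 2 * t * P.B t) := by ring
    rw [this, hAB, hr]
    linarith
  -- The expression is affine in `p`, which ranges over `[0, 2t‖v‖²]` by Cauchy–Schwarz; `hu` and
  -- `hw` settle the two endpoints.
  have key : 0 ≤ (P.ricciA n t - m * P.A t) * ‖v‖ ^ 2 + (P.ricciB n t - m * P.B t) * p := by
    rcases le_total 0 (P.ricciB n t - m * P.B t) with hq | hq
    · positivity
    · have h3 := mul_le_mul_of_nonpos_left hcs hq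
      have h4 := mul_nonneg hw hv
      linarith
  linarith

lemma ricciDefect_le (y : EuclideanSpace ℝ (Fin n)) (L : ℝ) (hL : 0 ≤ L)
    (h1 : (n - 1) * P.radialCurv (‖y‖ ^ 2 / 2) ≤ n - 1 + L)
    (h2 : -(n - 1 + L) * P.A (‖y‖ ^ 2 / 2) ≤ P.ricciA n (‖y‖ ^ 2 / 2)) :
    ricciDefect n (P.toSpace y) ≤ L := by
  refine max_le ?_ hL
  rw [neg_le]
  -- An infimum over an empty sphere would take the default value `0`, which also satisfies the
  -- bound.
  rcases isEmpty_or_nonempty {v : TangentSpace (𝓡 n) (P.toSpace y) // ‖v‖ = 1} with he | he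
  · rw [Real.iInf_of_isEmpty]
    linarith
  · refine le_ciInf fun v => ?_
    have h := P.le_ricci_self y v.1 (-(n - 1 + L)) (by linarith) h2
    have hv : P.form y v.1 v.1 = 1 := by
      have := P.norm_sq_eq (P.toSpace y) v.1
      rw [v.2] at this
      rw [one_pow] at this
      exact this.symm
    rw [hv] at h
    linarith

/-- The bound of `ricciDefect_le` away from the origin. -/
lemma ricciDefect_le_of_ne_zero (hn : 2 ≤ n) (y : EuclideanSpace ℝ (Fin n)) (hy : y ≠ 0) (L : ℝ)
    (hL : 0 ≤ L) (h1 : (n - 1) * P.radialCurv (‖y‖ ^ 2 / 2) ≤ n - 1 + L)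
    (h2 : ‖y‖ ^ 2 * P.radialCurv (‖y‖ ^ 2 / 2) + (n - 2) * (1 + ‖y‖ ^ 2 * P.C (‖y‖ ^ 2 / 2)) ^ 2
      ≤ ‖y‖ ^ 2 * (n - 1 + L)) :
    ricciDefect n (P.toSpace y) ≤ L := by
  refine P.ricciDefect_le y L hL h1 ?_
  have hA := P.A_pos (‖y‖ ^ 2 / 2)
  have h3 := P.two_mul_ricciA (n := n) (‖y‖ ^ 2 / 2)
  have h4 : 2 * (‖y‖ ^ 2 / 2) = ‖y‖ ^ 2 := by ring
  rw [h4] at h3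
  have h5 : (0 : ℝ) < ‖y‖ ^ 2 := by positivity
  have hn' : (2 : ℝ) ≤ n := by exact_mod_cast hn
  -- After multiplication by `‖y‖²`, `two_mul_ricciA` applies; the nonnegative term `n - 2` that it
  -- leaves over is dropped.
  refine le_of_mul_le_mul_left ?_ h5
  rw [h3]
  have := mul_le_mul_of_nonneg_left h2 hA.le
  nlinarith

lemma continuous_radialCurv : Continuous P.radialCurv := by
  have h1 := P.contDiff_C.continuous
  have h2 := (contDiff_infty_iff_deriv.1 P.contDiff_C).2.continuous
  unfold radialCurv
  fun_prop

lemma continuous_ricciA : Continuous (P.ricciA n) := by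
  have h1 := P.contDiff_C.continuous
  have h2 := (contDiff_infty_iff_deriv.1 P.contDiff_D).2.continuous
  have h3 := P.contDiff_D.continuous
  unfold ricciA
  fun_prop

/-- The Ricci defect is bounded on balls. -/
lemma exists_ricciDefect_le (hn : 1 ≤ n) (R : ℝ) : ∃ L : ℝ, ∀ y : EuclideanSpace ℝ (Fin n), ‖y‖ ≤ R →
    ricciDefect n (P.toSpace y) ≤ L := by
  obtain ⟨b₁, hb₁⟩ := isCompact_Icc.exists_bound_of_continuousOn
    (f := fun t => (n - 1) * P.radialCurv t) (s := Set.Icc 0 (R ^ 2 / 2))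
    (by have := P.continuous_radialCurv; fun_prop)
  obtain ⟨b₂, hb₂⟩ := isCompact_Icc.exists_bound_of_continuousOn
    (f := P.ricciA n) (s := Set.Icc 0 (R ^ 2 / 2)) P.continuous_ricciA.continuousOn
  refine ⟨max (b₁ + 1) (b₂ + 1) ⊔ 0, fun y hy => ?_⟩
  have ht : ‖y‖ ^ 2 / 2 ∈ Set.Icc 0 (R ^ 2 / 2) :=
    ⟨by positivity, by have := norm_nonneg y; gcongr⟩
  have h1 := hb₁ _ ht
  have h2 := hb₂ _ ht
  rw [Real.norm_eq_abs] at h1 h2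
  have h1 := (abs_le.1 h1).2
  have h2 := (abs_le.1 h2).1
  set L := max (b₁ + 1) (b₂ + 1) ⊔ 0
  have hL0 : 0 ≤ L := le_sup_right
  have hL1 : b₁ + 1 ≤ L := le_trans (le_max_left _ _) le_sup_left
  have hL2 : b₂ + 1 ≤ L := le_trans (le_max_right _ _) le_sup_left
  have hn : (1 : ℝ) ≤ n := by exact_mod_cast hn
  refine P.ricciDefect_le y L hL0 (by linarith) ?_
  -- Since `A ≥ 1`, a lower bound for `ricciA` itself suffices.
  have hA := P.one_le_A (‖y‖ ^ 2 / 2)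
  have : (n - 1 + L) * 1 ≤ (n - 1 + L) * P.A (‖y‖ ^ 2 / 2) := by gcongr
  linarith

end

end RadialProfile

/-! ### Lower bound for the bottom of the spectrum -/

lemma ContinuousLinearMap.norm_eq_of_forall_inner {F : Type*} [NormedAddCommGroup F]
    [InnerProductSpace ℝ F] (L : F →L[ℝ] ℝ) (ξ : F) (h : ∀ w, L w = inner ℝ ξ w) :
    ‖L‖ = ‖ξ‖ := by
  have : L = innerSL ℝ ξ := by
    ext w
    rw [h, innerSL_apply_apply]
  rw [this, innerSL_apply_norm]

/-- The integral of a partial derivative of a compactly supported function vanishes. -/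
lemma integral_partialDeriv_eq_zero {n : ℕ} (i : Fin n) {f : EuclideanSpace ℝ (Fin n) → ℝ}
    (hf : ContDiff ℝ 1 f) (hc : HasCompactSupport f) :
    ∫ y, IntegralRicci.partialDeriv i f y = 0 := by
  have h1 : Continuous fun y => fderiv ℝ f y (EuclideanSpace.single i 1) :=
    (hf.continuous_fderiv one_ne_zero).clm_apply continuous_const
  have h2 : HasCompactSupport fun y => fderiv ℝ f y (EuclideanSpace.single i 1) :=
    hc.fderiv_apply ℝ _
  have := integral_mul_fderiv_eq_neg_fderiv_mul_of_integrable (𝕜 := ℝ)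
    (μ := (volume : Measure (EuclideanSpace ℝ (Fin n)))) (f := fun _ => 1) (g := f)
    (v := EuclideanSpace.single i 1) (by simp)
    (by simpa using h1.integrable_of_hasCompactSupport h2)
    (by simpa using hf.continuous.integrable_of_hasCompactSupport hc)
    (fun _ _ => differentiableAt_const _)
    (fun x _ => hf.differentiable one_ne_zero x)
  simpa [IntegralRicci.partialDeriv] using this

namespace RadialProfile

noncomputable section

open IntegralRicci

variable (P : RadialProfile) {n : ℕ}

/-- The radial vector `x` has the same length `‖x‖` in both metrics. -/
lemma abs_differential_le (φ : P.Space n → ℝ) (x : EuclideanSpace ℝ (Fin n)) :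
    |fderiv ℝ (fun y => φ (P.toSpace y)) x x| ≤ gradNorm n φ (P.toSpace x) * ‖x‖ := by
  have h := (differential n φ (P.toSpace x)).le_opNorm x
  rw [differential_eq] at h
  refine h.trans (mul_le_mul_of_nonneg_left ?_ (norm_nonneg _))
  refine (abs_le_of_sq_le_sq' ?_ (norm_nonneg _)).2
  refine (P.norm_sq_eq (P.toSpace x) x).trans_le ?_
  refine (P.form_apply x x x).trans_le ?_
  rw [real_inner_self_eq_norm_sq]
  have : (P.A (‖x‖ ^ 2 / 2) + 2 * (‖x‖ ^ 2 / 2) * P.B (‖x‖ ^ 2 / 2)) * ‖x‖ ^ 2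
      = 1 * ‖x‖ ^ 2 := by rw [P.A_add_B]
  linarith

lemma gradNorm_sq (φ : P.Space n → ℝ) (x : EuclideanSpace ℝ (Fin n)) :
    gradNorm n φ (P.toSpace x) ^ 2 = (P.A (‖x‖ ^ 2 / 2))⁻¹ *
      (‖fderiv ℝ (fun y => φ (P.toSpace y)) x‖ ^ 2
        - P.B (‖x‖ ^ 2 / 2) * (fderiv ℝ (fun y => φ (P.toSpace y)) x x) ^ 2) := by
  set ℓ := fderiv ℝ (fun y => φ (P.toSpace y)) x
  have hA := (P.A_pos (‖x‖ ^ 2 / 2)).ne'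
  have hAB := P.A_add_B (‖x‖ ^ 2 / 2)
  let u : EuclideanSpace ℝ (Fin n) := (InnerProductSpace.toDual ℝ _).symm ℓ
  have hu : ∀ w, inner ℝ u w = ℓ w := fun w => InnerProductSpace.toDual_symm_apply
  have hun : ‖ℓ‖ = ‖u‖ := ((InnerProductSpace.toDual ℝ _).symm.norm_map ℓ).symm
  have hux : inner ℝ x u = ℓ x := by rw [real_inner_comm, hu]
  set a := P.A (‖x‖ ^ 2 / 2)
  set b := P.B (‖x‖ ^ 2 / 2)
  -- The Riemannian gradient: the inverse metric `A⁻¹ (1 - B x xᵀ)` applied to the Euclidean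
  -- gradient `u`.
  let ξ : EuclideanSpace ℝ (Fin n) := a⁻¹ • (u - (b * ℓ x) • x)
  have hxξ : inner ℝ x ξ = ℓ x := by
    simp only [ξ, inner_smul_right, inner_sub_right, real_inner_self_eq_norm_sq, hux]
    field_simp
    linear_combination (- ℓ x) * hAB
  have hform : ∀ w, P.form x ξ w = ℓ w := by
    intro w
    rw [form_apply, hxξ]
    simp only [ξ, inner_smul_left, inner_sub_left, hu]
    simp only [conj_trivial]
    change a * (a⁻¹ * (ℓ w - b * ℓ x * inner ℝ x w)) + b * (ℓ x * inner ℝ x w) = ℓ w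
    field_simp
    ring
  have h := (differential n φ (P.toSpace x)).norm_eq_of_forall_inner ξ fun w =>
    (P.differential_eq φ x w).trans (hform w).symm
  have h2 : gradNorm n φ (P.toSpace x) ^ 2 = P.form x ξ ξ := by
    rw [gradNorm, h]
    exact P.norm_sq_eq (P.toSpace x) ξ
  have hℓu : ℓ u = ‖u‖ ^ 2 := by rw [← hu, real_inner_self_eq_norm_sq]
  rw [h2, hform, hun]
  simp only [ξ, map_smul, map_sub, hℓu, smul_eq_mul]
  ring

variable (n) in
/-- The Riemannian density as a function of `|x|² / 2`. -/
def radialDensity (t : ℝ) : ℝ := Real.exp ((n - 1) * P.G t)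

lemma hasDerivAt_radialDensity (t : ℝ) :
    HasDerivAt (P.radialDensity n) ((n - 1) * P.C t * P.radialDensity n t) t := by
  have h : HasDerivAt P.G (P.C t) t :=
    (P.contDiff.differentiable (by simp) t).hasDerivAt
  have := (h.const_mul ((n : ℝ) - 1)).exp
  rwa [mul_comm] at this

/-- The weighted Hardy-type inequality obtained from a radial vector field `-Q(|x|²/2) x`. -/
lemma integral_sq_le_integral_gradNorm_sq (Q : ℝ → ℝ) (hQ : ContDiffOn ℝ ∞ Q (Set.Ioi (-1 / 8)))
    (b : ℝ) (hb : ∀ t, 0 ≤ t → b ≤ n * Q t + 2 * t * deriv Q t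
      + 2 * t * ((n - 1) * P.C t) * Q t - 2 * t * Q t ^ 2)
    (φ : P.Space n → ℝ) (hφ : ContDiff ℝ ∞ fun y => φ (P.toSpace y))
    (hc : HasCompactSupport fun y => φ (P.toSpace y)) :
    b * ∫ y, P.density n y * φ (P.toSpace y) ^ 2 ≤
      ∫ y, P.density n y * gradNorm n φ (P.toSpace y) ^ 2 := by
  set f : EuclideanSpace ℝ (Fin n) → ℝ := fun y => φ (P.toSpace y)
  have ht : ∀ y : EuclideanSpace ℝ (Fin n), ‖y‖ ^ 2 / 2 ∈ Set.Ioi (-1 / 8 : ℝ) := fun y =>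
    lt_of_lt_of_le (by norm_num) (show (0 : ℝ) ≤ ‖y‖ ^ 2 / 2 by positivity)
  have hT : ContDiff ℝ ∞ (fun y : EuclideanSpace ℝ (Fin n) => ‖y‖ ^ 2 / 2) :=
    (contDiff_norm_sq ℝ).div_const _
  have hQy : ContDiff ℝ ∞ (fun y : EuclideanSpace ℝ (Fin n) => Q (‖y‖ ^ 2 / 2)) :=
    hQ.comp_contDiff hT ht
  have hQd : ∀ y : EuclideanSpace ℝ (Fin n), DifferentiableAt ℝ Q (‖y‖ ^ 2 / 2) := fun y =>
    (hQ.contDiffAt (Ioi_mem_nhds (ht y))).differentiableAt (by simp)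
  have hcoord : ∀ i : Fin n, ContDiff ℝ ∞ (fun y : EuclideanSpace ℝ (Fin n) => y i) := fun i =>
    (EuclideanSpace.proj (𝕜 := ℝ) i).contDiff
  -- The components of the compactly supported field `f² Q ρ y`, with `ρ` the Riemannian density;
  -- its divergence integrates to zero.
  let h : Fin n → EuclideanSpace ℝ (Fin n) → ℝ := fun i y =>
    (f y * f y) * ((Q (‖y‖ ^ 2 / 2) * P.radialDensity n (‖y‖ ^ 2 / 2)) * y i)
  have hdens : ∀ y : EuclideanSpace ℝ (Fin n), P.radialDensity n (‖y‖ ^ 2 / 2) = P.density n y :=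
    fun y => rfl
  have hsm : ∀ i, ContDiff ℝ ∞ (h i) := fun i =>
    (hφ.mul hφ).mul ((hQy.mul P.contDiff_density).mul (hcoord i))
  have hcs : ∀ i, HasCompactSupport (h i) := fun i => (hc.mul_right (f' := f)).mul_right
  have hdiv : ∀ y, ∑ i, partialDeriv i (h i) y = P.density n y * (2 * f y * Q (‖y‖ ^ 2 / 2)
      * fderiv ℝ f y y + f y ^ 2 * (n * Q (‖y‖ ^ 2 / 2) + 2 * (‖y‖ ^ 2 / 2) * deriv Q (‖y‖ ^ 2 / 2)
      + 2 * (‖y‖ ^ 2 / 2) * ((n - 1) * P.C (‖y‖ ^ 2 / 2)) * Q (‖y‖ ^ 2 / 2))) := by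
    intro y
    have hfd : ∀ i, HasPartialDerivAt i f (fderiv ℝ f y (EuclideanSpace.single i 1)) y := fun i =>
      ⟨_, (hφ.differentiable (by simp) y).hasFDerivAt, rfl⟩
    have hd := fun i => ((hfd i).mul (hfd i)).mul
      (((HasPartialDerivAt.radial (i := i) (hQd y)).mul
        (HasPartialDerivAt.radial (i := i) (P.hasDerivAt_radialDensity (n := n) _).differentiableAt)).mul
        (HasPartialDerivAt.coord i))
    have hd := fun i => (hd i).partialDeriv_eq
    have hs := sum_mul_self y
    have hy : ∀ L : EuclideanSpace ℝ (Fin n) →L[ℝ] ℝ,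
        L y = ∑ i, y i * L (EuclideanSpace.single i 1) := fun L => by
      conv_lhs => rw [← (EuclideanSpace.basisFun (Fin n) ℝ).sum_repr y]
      simp
    have hy := hy (fderiv ℝ f y)
    simp only [h, hd, (P.hasDerivAt_radialDensity _).deriv, if_true]
    rw [hdens]
    set t := ‖y‖ ^ 2 / 2
    have hi : ∀ i, (fderiv ℝ f y (EuclideanSpace.single i 1) * f y
          + f y * fderiv ℝ f y (EuclideanSpace.single i 1)) * (Q t * P.density n y * y i)
        + f y * f y * ((deriv Q t * y i * P.density n y
          + Q t * ((n - 1) * P.C t * P.density n y * y i)) * y i + Q t * P.density n y * 1)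
        = (2 * f y * Q t * P.density n y) * (y i * fderiv ℝ f y (EuclideanSpace.single i 1))
        + (f y * f y * P.density n y * (deriv Q t + (n - 1) * P.C t * Q t)) * (y i * y i)
        + f y * f y * (Q t * P.density n y) := by
      intro i
      ring
    simp_rw [hi, Finset.sum_add_distrib, ← Finset.mul_sum, hs, ← hy]
    simp only [Finset.sum_const, Finset.card_univ, Fintype.card_fin, nsmul_eq_mul]
    ring
  have hpc : ∀ i, Continuous fun y => partialDeriv i (h i) y := fun i =>
    ((hsm i).continuous_fderiv (by simp)).clm_apply continuous_const
  have hpi : ∀ i, Integrable fun y => partialDeriv i (h i) y := fun i =>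
    (hpc i).integrable_of_hasCompactSupport ((hcs i).fderiv_apply ℝ _)
  have hzero : ∫ y, ∑ i, partialDeriv i (h i) y = 0 := by
    rw [integral_finsetSum _ fun i _ => hpi i]
    exact Finset.sum_eq_zero fun i _ => integral_partialDeriv_eq_zero i
      ((hsm i).of_le (by simp)) (hcs i)
  have hi1 : Integrable fun y => P.density n y * φ (P.toSpace y) ^ 2 := by
    refine Continuous.integrable_of_hasCompactSupport
      (P.contDiff_density.continuous.mul (hφ.continuous.pow 2)) ?_
    have : HasCompactSupport (fun y => f y ^ 2) := by
      simp_rw [sq]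
      exact hc.mul_right
    exact this.mul_left
  have hi2 : Integrable fun y => P.density n y * gradNorm n φ (P.toSpace y) ^ 2 := by
    simp_rw [gradNorm_sq]
    have h1 := hφ.continuous_fderiv (by simp)
    have h2 : HasCompactSupport (fderiv ℝ f) := hc.fderiv ℝ
    have h3 := (P.contDiff_A.comp hT).continuous
    have h4 := (P.contDiff_B.comp hT).continuous
    have h5 : ∀ y : EuclideanSpace ℝ (Fin n), P.A (‖y‖ ^ 2 / 2) ≠ 0 := fun y => (P.A_pos _).ne'
    refine Continuous.integrable_of_hasCompactSupport
      (P.contDiff_density.continuous.mul ((h3.inv₀ h5).mul ((h1.norm.pow 2).sub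
        (h4.mul ((h1.clm_apply continuous_id).pow 2))))) ?_
    refine h2.mono fun y hy => ?_
    contrapose! hy
    have hz : fderiv ℝ (fun y => φ (P.toSpace y)) y = 0 := Function.notMem_support.1 hy
    rw [Function.notMem_support, hz]
    simp
  rw [← integral_const_mul]
  have hle : ∀ y, b * (P.density n y * φ (P.toSpace y) ^ 2) - ∑ i, partialDeriv i (h i) y
      ≤ P.density n y * gradNorm n φ (P.toSpace y) ^ 2 := by
    intro y
    rw [hdiv]
    have h1 := hb (‖y‖ ^ 2 / 2) (by positivity)
    have h2 := P.abs_differential_le φ y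
    -- The cross term is absorbed by `2XY ≤ X² + Y²` with `X = |f Q| ‖y‖` and `Y = |∇φ|`; the cost
    -- `2t Q²` is the last term of `hb`.
    have h3 : -(2 * f y * Q (‖y‖ ^ 2 / 2) * fderiv ℝ f y y) ≤ gradNorm n φ (P.toSpace y) ^ 2
        + f y ^ 2 * (2 * (‖y‖ ^ 2 / 2) * Q (‖y‖ ^ 2 / 2) ^ 2) := by
      have h4 : |f y * Q (‖y‖ ^ 2 / 2) * fderiv ℝ f y y| ≤
          |f y * Q (‖y‖ ^ 2 / 2)| * ‖y‖ * gradNorm n φ (P.toSpace y) := by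
        rw [abs_mul]
        calc _ ≤ |f y * Q (‖y‖ ^ 2 / 2)| * (gradNorm n φ (P.toSpace y) * ‖y‖) := by gcongr
          _ = _ := by ring
      have h5 := neg_le_abs (f y * Q (‖y‖ ^ 2 / 2) * fderiv ℝ f y y)
      have h6 := two_mul_le_add_sq (|f y * Q (‖y‖ ^ 2 / 2)| * ‖y‖) (gradNorm n φ (P.toSpace y))
      have h7 : (|f y * Q (‖y‖ ^ 2 / 2)| * ‖y‖) ^ 2
          = f y ^ 2 * (2 * (‖y‖ ^ 2 / 2) * Q (‖y‖ ^ 2 / 2) ^ 2) := by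
        rw [mul_pow, sq_abs]
        ring
      linarith
    have h8 := mul_le_mul_of_nonneg_left h1 (sq_nonneg (f y))
    have h9 : b * f y ^ 2 - (2 * f y * Q (‖y‖ ^ 2 / 2)
      * fderiv ℝ f y y + f y ^ 2 * (n * Q (‖y‖ ^ 2 / 2) + 2 * (‖y‖ ^ 2 / 2) * deriv Q (‖y‖ ^ 2 / 2)
      + 2 * (‖y‖ ^ 2 / 2) * ((n - 1) * P.C (‖y‖ ^ 2 / 2)) * Q (‖y‖ ^ 2 / 2)))
      ≤ gradNorm n φ (P.toSpace y) ^ 2 := by linarith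
    have := mul_le_mul_of_nonneg_left h9 (P.density_pos y).le
    change b * (P.density n y * f y ^ 2) - _ ≤ _
    linarith
  have hint := integral_mono ((hi1.const_mul b).sub (integrable_finsetSum _ fun i _ => hpi i))
    hi2 hle
  have h0 : ∫ y, (b * (P.density n y * φ (P.toSpace y) ^ 2) - ∑ i, partialDeriv i (h i) y)
      = ∫ y, b * (P.density n y * φ (P.toSpace y) ^ 2) := by
    rw [integral_sub (hi1.const_mul b) (integrable_finsetSum _ fun i _ => hpi i), hzero, sub_zero]
  rw [← h0]
  exact hint

/-- The field `Q x` with `Q = a / √(r² + 1/4)` is `a ∇r` smoothed at the origin. The hypothesis is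
the matching form of `Δr ≥ 2a`, where `Δr = (n-1)(1 + 2tC)/r`. -/
lemma le_bottomSpectrum (hn : 1 ≤ n) (a : ℝ) (ha : 0 ≤ a)
    (h : ∀ t, 0 ≤ t → 2 * a * √(2 * t + 1 / 4) ≤ (n - 1) * (1 + 2 * t * P.C t)) :
    a ^ 2 ≤ bottomSpectrum n (P.Space n) := by
  let Q : ℝ → ℝ := fun t => a / √(2 * t + 1 / 4)
  have hpos : ∀ t ∈ Set.Ioi (-1 / 8 : ℝ), 0 < 2 * t + 1 / 4 := fun t ht => by
    have : -1 / 8 < t := ht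
    linarith
  have hQ : ContDiffOn ℝ ∞ Q (Set.Ioi (-1 / 8)) := by
    refine contDiffOn_const.div (ContDiffOn.sqrt (by fun_prop) fun t ht => (hpos t ht).ne') ?_
    exact fun t ht => (Real.sqrt_pos.2 (hpos t ht)).ne'
  have hQ' : ∀ t, 0 ≤ t → deriv Q t = -(a / √(2 * t + 1 / 4) ^ 3) := by
    intro t ht
    have hp : 0 < 2 * t + 1 / 4 := by linarith
    have hs := Real.sqrt_pos.2 hp
    have h1 : HasDerivAt (fun t : ℝ => 2 * t + 1 / 4) 2 t := by
      simpa using ((hasDerivAt_id t).const_mul (2 : ℝ)).add_const (1 / 4 : ℝ)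
    have h2 := (hasDerivAt_const t a).div (h1.sqrt hp.ne') hs.ne'
    refine h2.deriv.trans ?_
    field_simp
    ring
  have hb : ∀ t, 0 ≤ t → a ^ 2 ≤ n * Q t + 2 * t * deriv Q t
      + 2 * t * ((n - 1) * P.C t) * Q t - 2 * t * Q t ^ 2 := by
    intro t ht
    rw [hQ' t ht]
    have hp : 0 < 2 * t + 1 / 4 := by linarith
    have hs := Real.sqrt_pos.2 hp
    have hsq := Real.sq_sqrt hp.le
    have h1 := h t ht
    simp only [Q]
    set S := √(2 * t + 1 / 4)
    have ht' : 2 * t = S ^ 2 - 1 / 4 := by linarith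
    have h2 : a / S * (2 * a * S) ≤ a / S * ((n - 1) * (1 + 2 * t * P.C t)) := by gcongr
    have h3 : a / S * (2 * a * S) = 2 * a ^ 2 := by field_simp
    have h4 : 2 * t * (a / S) ^ 2 ≤ a ^ 2 := by
      rw [div_pow, mul_div_assoc', div_le_iff₀ (by positivity), ht']
      nlinarith [sq_nonneg a]
    -- Of the `n` copies of `a / S` in `n Q`, one cancels against this derivative term, up to a
    -- positive remainder; `h2` uses the other `n - 1`.
    have h5 : 2 * t * -(a / S ^ 3) = - (a / S) + a / (4 * S ^ 3) := by
      rw [ht']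
      field_simp
      ring
    have h6 : 0 ≤ a / (4 * S ^ 3) := by positivity
    rw [h5]
    linarith
  refine le_csInf ?_ ?_
  -- The infimum is over a set of reals and is bounded below this way only if the set is nonempty; a
  -- bump function supplies a member.
  · let β : ContDiffBump (0 : EuclideanSpace ℝ (Fin n)) := default
    refine ⟨_, fun x => β (P.toSpace.symm x), ?_, ?_, ?_, rfl⟩
    · exact (contMDiff_iff_contDiff (𝕜 := ℝ) (f := β)).2 β.contDiff
    · exact β.hasCompactSupport
    · intro h0
      have h1 : β 0 = 0 := congrFun h0 (P.toSpace 0)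
      rw [β.one_of_mem_closedBall (Metric.mem_closedBall_self β.rIn_pos.le)] at h1
      exact one_ne_zero h1
  · rintro r ⟨φ, hφ, hc, hne, rfl⟩
    have hφ' : ContDiff ℝ ∞ fun y => φ (P.toSpace y) := contMDiff_iff_contDiff.1 hφ
    have hc' : HasCompactSupport fun y => φ (P.toSpace y) := hc
    rw [P.integral_riemannianVolume hn, P.integral_riemannianVolume hn, le_div_iff₀]
    · exact P.integral_sq_le_integral_gradNorm_sq Q hQ (a ^ 2) hb φ hφ' hc'
    · obtain ⟨x, hx⟩ := Function.ne_iff.1 hne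
      refine Continuous.integral_pos_of_hasCompactSupport_nonneg_nonzero
        (x := P.toSpace.symm x) (P.contDiff_density.continuous.mul (hφ'.continuous.pow 2)) ?_
        (fun y => mul_nonneg (P.density_pos y).le (sq_nonneg _)) ?_
      · have : HasCompactSupport (fun y => φ (P.toSpace y) ^ 2) := by
          simp_rw [sq]
          exact hc'.mul_right
        exact this.mul_left
      · exact mul_ne_zero (P.density_pos _).ne' (pow_ne_zero 2 hx)

end

end RadialProfile

/-! ### A smooth approximation of the floor function -/

namespace Real.smoothTransition

lemma deriv_eq_zero_of_nonpos {x : ℝ} (hx : x ≤ 0) : deriv Real.smoothTransition x = 0 := by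
  refine IsLocalMin.deriv_eq_zero (Filter.Eventually.of_forall fun y => ?_)
  rw [zero_of_nonpos hx]
  exact nonneg y

lemma deriv_eq_zero_of_one_le {x : ℝ} (hx : 1 ≤ x) : deriv Real.smoothTransition x = 0 := by
  refine IsLocalMax.deriv_eq_zero (Filter.Eventually.of_forall fun y => ?_)
  rw [one_of_one_le hx]
  exact le_one y

lemma exists_deriv_le : ∃ M : ℝ, 0 ≤ M ∧ ∀ x, deriv Real.smoothTransition x ≤ M := by
  have hc : Continuous (deriv Real.smoothTransition) :=
    (contDiff_infty_iff_deriv.1 Real.smoothTransition.contDiff).2.continuous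
  obtain ⟨M, hM⟩ := isCompact_Icc.exists_bound_of_continuousOn (s := Set.Icc (0 : ℝ) 1)
    hc.continuousOn
  have hM0 : 0 ≤ M := (norm_nonneg _).trans (hM 0 (by simp))
  refine ⟨M, hM0, fun x => ?_⟩
  rcases le_total x 0 with h | h
  · rwa [deriv_eq_zero_of_nonpos h]
  rcases le_total 1 x with h' | h'
  · rwa [deriv_eq_zero_of_one_le h']
  · exact (le_abs_self _).trans (hM x ⟨h, h'⟩)

end Real.smoothTransition

/-- A smooth approximation of the floor function, whose `k`-th jump takes place on
`[k, k + ε k]`. -/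
noncomputable def smoothFloor (ε : ℕ → ℝ) (r : ℝ) : ℝ :=
  ∑ k ∈ Finset.range (⌊r⌋₊ + 1), Real.smoothTransition ((r - k) / ε k)

namespace smoothFloor

variable {ε : ℕ → ℝ}

/-- Steps that start beyond `r` contribute nothing. A fixed number of terms therefore works on a
whole neighbourhood, which is what smoothness needs. -/
lemma eq_sum (hε : ∀ k, 0 < ε k) {r : ℝ} {N : ℕ} (hr : r < N) :
    smoothFloor ε r = ∑ k ∈ Finset.range N, Real.smoothTransition ((r - k) / ε k) := by
  rcases Nat.eq_zero_or_pos N with rfl | hN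
  -- The natural floor of a negative number is `0`, so the term `k = 0` remains in the definition,
  -- but it vanishes.
  · have h0 : r < 0 := by simpa using hr
    have : ⌊r⌋₊ = 0 := Nat.floor_of_nonpos h0.le
    rw [smoothFloor, this]
    simp only [zero_add, Finset.range_one, Finset.sum_singleton, Nat.cast_zero, sub_zero,
      Finset.range_zero, Finset.sum_empty]
    exact Real.smoothTransition.zero_of_nonpos (div_nonpos_of_nonpos_of_nonneg h0.le (hε 0).le)
  · have hle : ⌊r⌋₊ + 1 ≤ N := (Nat.floor_lt' hN.ne').2 hr
    refine Finset.sum_subset (Finset.range_mono hle) fun k _ hk => ?_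
    have hk : ⌊r⌋₊ < k := by simpa using hk
    have : r < k := Nat.lt_of_floor_lt hk
    exact Real.smoothTransition.zero_of_nonpos
      (div_nonpos_of_nonpos_of_nonneg (by linarith) (hε k).le)

lemma eventuallyEq_sum (hε : ∀ k, 0 < ε k) {r : ℝ} {N : ℕ} (hr : r < N) :
    smoothFloor ε =ᶠ[nhds r]
      fun x => ∑ k ∈ Finset.range N, Real.smoothTransition ((x - k) / ε k) := by
  filter_upwards [Iio_mem_nhds hr] with x hx using eq_sum hε hx

lemma contDiff (hε : ∀ k, 0 < ε k) : ContDiff ℝ ∞ (smoothFloor ε) := by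
  rw [contDiff_iff_contDiffAt]
  intro r
  obtain ⟨N, hN⟩ := exists_nat_gt r
  refine ContDiffAt.congr_of_eventuallyEq ?_ (eventuallyEq_sum hε hN)
  refine (ContDiff.sum fun k _ => Real.smoothTransition.contDiff.comp ?_).contDiffAt
  exact (contDiff_id.sub contDiff_const).div_const _

lemma one_le_sub_div (hε : ∀ k, 0 < ε k) (hε1 : ∀ k, ε k ≤ 1)
    {r : ℝ} (hr : 0 ≤ r) {k : ℕ} (hk : k < ⌊r⌋₊) : 1 ≤ (r - k) / ε k := by
  rw [one_le_div (hε k)]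
  have h1 : ((k + 1 : ℕ) : ℝ) ≤ r := (Nat.cast_le.2 hk).trans (Nat.floor_le hr)
  push_cast at h1
  linarith [hε1 k]

lemma eq_floor_add (hε : ∀ k, 0 < ε k) (hε1 : ∀ k, ε k ≤ 1)
    {r : ℝ} (hr : 0 ≤ r) :
    smoothFloor ε r = ⌊r⌋₊ + Real.smoothTransition ((r - ⌊r⌋₊) / ε ⌊r⌋₊) := by
  rw [smoothFloor, Finset.sum_range_succ]
  congr 1
  rw [Finset.sum_congr rfl fun k hk => Real.smoothTransition.one_of_one_le
    (one_le_sub_div hε hε1 hr (Finset.mem_range.1 hk))]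
  simp

lemma abs_sub_le (hε : ∀ k, 0 < ε k) (hε1 : ∀ k, ε k ≤ 1)
    {r : ℝ} (hr : 0 ≤ r) : |r - smoothFloor ε r| ≤ 1 := by
  rw [eq_floor_add hε hε1 hr, abs_le]
  have h1 := Real.smoothTransition.nonneg ((r - ⌊r⌋₊) / ε ⌊r⌋₊)
  have h2 := Real.smoothTransition.le_one ((r - ⌊r⌋₊) / ε ⌊r⌋₊)
  have h3 := Nat.floor_le hr
  have h4 := Nat.lt_floor_add_one r
  constructor <;> linarith

/-- As `ε k ≤ 1`, all earlier jumps are complete by the time `r` reaches `⌊r⌋₊`, and the transition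
is flat from its endpoint on. Only the current jump contributes. -/
lemma deriv_eq (hε : ∀ k, 0 < ε k) (hε1 : ∀ k, ε k ≤ 1)
    {r : ℝ} (hr : 0 ≤ r) : deriv (smoothFloor ε) r
    = deriv Real.smoothTransition ((r - ⌊r⌋₊) / ε ⌊r⌋₊) / ε ⌊r⌋₊ := by
  have hlt : r < ((⌊r⌋₊ + 1 : ℕ) : ℝ) := by
    push_cast
    exact Nat.lt_floor_add_one r
  have hS : ∀ k, HasDerivAt (fun x : ℝ => Real.smoothTransition ((x - k) / ε k))
      (deriv Real.smoothTransition ((r - k) / ε k) / ε k) r := fun k => by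
    have h1 := (Real.smoothTransition.contDiff (n := 1)).differentiable one_ne_zero
      ((r - k) / ε k)
    have h2 : HasDerivAt (fun x : ℝ => (x - k) / ε k) (1 / ε k) r :=
      ((hasDerivAt_id r).sub_const _).div_const _
    have := h1.hasDerivAt.comp r h2
    rwa [mul_one_div] at this
  rw [(eventuallyEq_sum hε hlt).deriv_eq, (HasDerivAt.fun_sum fun k _ => hS k).deriv,
    Finset.sum_range_succ, Finset.sum_eq_zero, zero_add]
  intro k hk
  rw [Real.smoothTransition.deriv_eq_zero_of_one_le
    (one_le_sub_div hε hε1 hr (Finset.mem_range.1 hk)), zero_div]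

end smoothFloor

/-! ### Profiles with prescribed logarithmic derivative -/

namespace RadialProfile

noncomputable section

/-- Composition with `t ↦ √(2t)` preserves smoothness for functions vanishing near `(-∞, 0]`. -/
lemma contDiff_comp_sqrt {F : ℝ → ℝ} (hF : ContDiff ℝ ∞ F) (h0 : ∀ r ≤ (1 / 4 : ℝ), F r = 0) :
    ContDiff ℝ ∞ fun t => F (√(2 * t)) := by
  rw [contDiff_iff_contDiffAt]
  intro t
  rcases lt_or_ge t (1 / 32) with h | h
  · refine (contDiffAt_const (c := (0 : ℝ))).congr_of_eventuallyEq ?_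
    filter_upwards [Iio_mem_nhds h] with u hu
    refine h0 _ (Real.sqrt_le_iff.2 ⟨by norm_num, ?_⟩)
    have : u < 1 / 32 := hu
    linarith
  · refine hF.contDiffAt.comp t (ContDiffAt.sqrt (by fun_prop) ?_)
    linarith

lemma integral_rate_eq_zero (K : ℝ → ℝ) (h0 : ∀ r ≤ (1 / 4 : ℝ), K r = 0)
    {r : ℝ} (hr : r ≤ 1 / 4) : ∫ x in (1 / 4)..r, K x = 0 := by
  rw [intervalIntegral.integral_congr (g := fun _ => 0)]
  · simp
  · intro x hx
    rw [Set.uIcc_of_ge hr] at hx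
    exact h0 x hx.2

lemma hasDerivAt_integral_rate (K : ℝ → ℝ) (hK : ContDiff ℝ ∞ K)
    (r : ℝ) :
    HasDerivAt (fun r => ∫ x in (1 / 4)..r, K x) (K r) r :=
  hK.continuous.integral_hasStrictDerivAt _ _ |>.hasDerivAt

lemma contDiff_integral_rate (K : ℝ → ℝ) (hK : ContDiff ℝ ∞ K)
    : ContDiff ℝ ∞ fun r => ∫ x in (1 / 4)..r, K x := by
  rw [contDiff_infty_iff_deriv]
  have h := hasDerivAt_integral_rate K hK
  refine ⟨fun r => (h r).differentiableAt, ?_⟩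
  rwa [show deriv (fun r => ∫ x in (1 / 4)..r, K x) = K from funext fun r => (h r).deriv]

/-- The profile for which `G (r² / 2)` has derivative `K r` with respect to `r`. -/
def ofRate (K : ℝ → ℝ) (hK : ContDiff ℝ ∞ K) (h0 : ∀ r ≤ (1 / 4 : ℝ), K r = 0)
    (hnn : ∀ r, 0 ≤ K r) : RadialProfile where
  G t := ∫ x in (1 / 4)..√(2 * t), K x
  contDiff := contDiff_comp_sqrt (contDiff_integral_rate K hK)
    fun _ hr => integral_rate_eq_zero K h0 hr
  -- The rate vanishes for `r ≤ 1/4`, that is, for `r²/2 ≤ 1/32`.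
  c := 1 / 32
  c_pos := by norm_num
  eq_zero t ht := integral_rate_eq_zero K h0
    (Real.sqrt_le_iff.2 ⟨by norm_num, by linarith⟩)
  nonneg t := by
    rcases le_total √(2 * t) (1 / 4) with h | h
    · rw [integral_rate_eq_zero K h0 h]
    · exact intervalIntegral.integral_nonneg h fun x _ => hnn x

variable {K : ℝ → ℝ} (hK : ContDiff ℝ ∞ K) (h0 : ∀ r ≤ (1 / 4 : ℝ), K r = 0)
  (hnn : ∀ r, 0 ≤ K r)

lemma sqrt_two_mul_sq_div_two {r : ℝ} (hr : 0 ≤ r) : √(2 * (r ^ 2 / 2)) = r := by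
  rw [mul_div_cancel₀ _ two_ne_zero, Real.sqrt_sq hr]

lemma hasDerivAt_sqrt_two_mul {t : ℝ} (ht : 0 < t) :
    HasDerivAt (fun t => √(2 * t)) (1 / √(2 * t)) t := by
  have h1 : HasDerivAt (fun t : ℝ => 2 * t) 2 t := by
    simpa using (hasDerivAt_id t).const_mul (2 : ℝ)
  have h2 := h1.sqrt (by positivity)
  convert h2 using 1
  field_simp

lemma ofRate_C_of_pos {t : ℝ} (ht : 0 < t) :
    (ofRate K hK h0 hnn).C t = K √(2 * t) / √(2 * t) := by
  have := (hasDerivAt_integral_rate K hK √(2 * t)).comp t (hasDerivAt_sqrt_two_mul ht)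
  rw [mul_one_div] at this
  exact this.deriv

lemma ofRate_C {r : ℝ} (hr : 0 < r) : (ofRate K hK h0 hnn).C (r ^ 2 / 2) = K r / r := by
  rw [ofRate_C_of_pos hK h0 hnn (by positivity), sqrt_two_mul_sq_div_two hr.le]

lemma ofRate_deriv_C {r : ℝ} (hr : 0 < r) :
    deriv (ofRate K hK h0 hnn).C (r ^ 2 / 2) = (deriv K r * r - K r) / r ^ 3 := by
  have ht : 0 < r ^ 2 / 2 := by positivity
  have h1 : (ofRate K hK h0 hnn).C =ᶠ[nhds (r ^ 2 / 2)] fun t => K √(2 * t) / √(2 * t) := by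
    filter_upwards [Ioi_mem_nhds ht] with t ht using ofRate_C_of_pos hK h0 hnn ht
  have h2 := hasDerivAt_sqrt_two_mul ht
  have h3 := ((hK.differentiable (by simp) √(2 * (r ^ 2 / 2))).hasDerivAt.comp (r ^ 2 / 2) h2).div h2
    (by rw [sqrt_two_mul_sq_div_two hr.le]; exact hr.ne')
  rw [h1.deriv_eq]
  refine h3.deriv.trans ?_
  rw [Function.comp_apply, sqrt_two_mul_sq_div_two hr.le]
  field_simp

/-- This is `f''/f = (f'/f)' + (f'/f)²` for `f'/f = 1/r + K`. -/
lemma ofRate_radialCurv {r : ℝ} (hr : 0 < r) :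
    (ofRate K hK h0 hnn).radialCurv (r ^ 2 / 2) = deriv K r + K r ^ 2 + 2 * K r / r := by
  rw [radialCurv, ofRate_deriv_C hK h0 hnn hr, ofRate_C hK h0 hnn hr]
  field_simp
  ring

lemma ofRate_G_le {b : ℝ} (hb : ∀ r, K r ≤ b) {r : ℝ} (hr : 0 ≤ r) :
    (ofRate K hK h0 hnn).G (r ^ 2 / 2) ≤ b * r := by
  have hb0 : 0 ≤ b := (hnn 0).trans (hb 0)
  change ∫ x in (1 / 4)..√(2 * (r ^ 2 / 2)), K x ≤ b * r
  rw [sqrt_two_mul_sq_div_two hr]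
  rcases le_total r (1 / 4) with h | h
  · rw [integral_rate_eq_zero K h0 h]
    positivity
  · have := intervalIntegral.integral_mono_on (μ := volume) h (hK.continuous.intervalIntegrable _ _)
      (intervalIntegrable_const (c := b)) fun x _ => hb x
    rw [intervalIntegral.integral_const, smul_eq_mul] at this
    nlinarith

end

end RadialProfile

/-! ### The sawtooth rate -/

/-- A rate which, for `r ≥ 1/2`, stays between `5/4` and `7/4` and decreases with slope `-N/4`
outside short intervals `[k / N, (k + ε k) / N]`. -/
noncomputable def sawtoothRate (N : ℝ) (ε : ℕ → ℝ) (r : ℝ) : ℝ :=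
  Real.smoothTransition (4 * r - 1) * (3 / 2 - (N * r - smoothFloor ε (N * r)) / 4)

namespace sawtoothRate

variable {N : ℝ} {ε : ℕ → ℝ}

lemma contDiff (hε : ∀ k, 0 < ε k) : ContDiff ℝ ∞ (sawtoothRate N ε) := by
  have h1 : ContDiff ℝ ∞ fun r : ℝ => N * r := contDiff_const.mul contDiff_id
  refine (Real.smoothTransition.contDiff.comp
    ((contDiff_const.mul contDiff_id).sub contDiff_const)).mul ?_
  exact contDiff_const.sub ((h1.sub ((smoothFloor.contDiff hε).comp h1)).div_const _)

lemma eq_zero {r : ℝ} (hr : r ≤ 1 / 4) : sawtoothRate N ε r = 0 := by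
  rw [sawtoothRate, Real.smoothTransition.zero_of_nonpos (by linarith), zero_mul]

lemma nonneg (hN : 0 ≤ N) (hε : ∀ k, 0 < ε k) (hε1 : ∀ k, ε k ≤ 1) (r : ℝ) :
    0 ≤ sawtoothRate N ε r := by
  rcases le_total r (1 / 4) with h | h
  · rw [eq_zero h]
  · have h1 := abs_le.1 (smoothFloor.abs_sub_le hε hε1 (r := N * r) (by positivity))
    exact mul_nonneg (Real.smoothTransition.nonneg _) (by linarith [h1.2])

lemma le (hN : 0 ≤ N) (hε : ∀ k, 0 < ε k) (hε1 : ∀ k, ε k ≤ 1) (r : ℝ) :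
    sawtoothRate N ε r ≤ 7 / 4 := by
  rcases le_total r (1 / 4) with h | h
  · rw [eq_zero h]
    norm_num
  · have h1 := abs_le.1 (smoothFloor.abs_sub_le hε hε1 (r := N * r) (by positivity))
    have h2 := Real.smoothTransition.nonneg (4 * r - 1)
    have h3 := Real.smoothTransition.le_one (4 * r - 1)
    rw [sawtoothRate]
    nlinarith [h1.1, h1.2]

lemma eq_of_le {r : ℝ} (hr : 1 / 2 ≤ r) :
    sawtoothRate N ε r = 3 / 2 - (N * r - smoothFloor ε (N * r)) / 4 := by
  rw [sawtoothRate, Real.smoothTransition.one_of_one_le (by linarith), one_mul]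

lemma ge (hN : 0 ≤ N) (hε : ∀ k, 0 < ε k) (hε1 : ∀ k, ε k ≤ 1) {r : ℝ} (hr : 1 / 2 ≤ r) :
    5 / 4 ≤ sawtoothRate N ε r := by
  have h1 := abs_le.1 (smoothFloor.abs_sub_le hε hε1 (r := N * r) (by positivity))
  rw [eq_of_le hr]
  linarith [h1.2]

lemma deriv_eq (hε : ∀ k, 0 < ε k) {r : ℝ} (hr : 1 / 2 < r) :
    deriv (sawtoothRate N ε) r = N / 4 * deriv (smoothFloor ε) (N * r) - N / 4 := by
  have h1 : sawtoothRate N ε =ᶠ[nhds r]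
      fun r => 3 / 2 - (N * r - smoothFloor ε (N * r)) / 4 := by
    filter_upwards [Ioi_mem_nhds hr] with x hx using eq_of_le (le_of_lt hx)
  have h2 : HasDerivAt (fun r => N * r) N r := by
    simpa using (hasDerivAt_id r).const_mul N
  have h3 := ((smoothFloor.contDiff hε).differentiable (by simp) (N * r)).hasDerivAt.comp r h2
  rw [h1.deriv_eq]
  refine (((h2.sub h3).div_const 4).const_sub (3 / 2)).deriv.trans ?_
  ring

end sawtoothRate

/-! ### Spectrum and Ricci defect of the sawtooth metrics -/

namespace RadialProfile

noncomputable section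

open IntegralRicci

lemma steepness_nonneg {n : ℕ} (hn : 2 ≤ n) : (0 : ℝ) ≤ 32 * (n - 1) := by
  have : (2 : ℝ) ≤ n := by exact_mod_cast hn
  linarith

/-- The sawtooth profile in dimension `n`. -/
def sawtooth (n : ℕ) (hn : 2 ≤ n) (ε : ℕ → ℝ) (hε : ∀ k, 0 < ε k) (hε1 : ∀ k, ε k ≤ 1) :
    RadialProfile :=
  ofRate (sawtoothRate (32 * (n - 1)) ε) (sawtoothRate.contDiff hε)
    (fun _ hr => sawtoothRate.eq_zero hr) (sawtoothRate.nonneg (steepness_nonneg hn) hε hε1)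

variable {n : ℕ} (hn : 2 ≤ n) {ε : ℕ → ℝ} (hε : ∀ k, 0 < ε k) (hε1 : ∀ k, ε k ≤ 1)

lemma sawtooth_C {r : ℝ} (hr : 0 < r) : (sawtooth n hn ε hε hε1).C (r ^ 2 / 2)
    = sawtoothRate (32 * (n - 1)) ε r / r :=
  ofRate_C (sawtoothRate.contDiff hε) (fun _ hr => sawtoothRate.eq_zero hr)
    (sawtoothRate.nonneg (steepness_nonneg hn) hε hε1) hr

lemma sawtooth_radialCurv {r : ℝ} (hr : 0 < r) :
    (sawtooth n hn ε hε hε1).radialCurv (r ^ 2 / 2) = deriv (sawtoothRate (32 * (n - 1)) ε) r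
      + sawtoothRate (32 * (n - 1)) ε r ^ 2 + 2 * sawtoothRate (32 * (n - 1)) ε r / r :=
  ofRate_radialCurv (sawtoothRate.contDiff hε) (fun _ hr => sawtoothRate.eq_zero hr)
    (sawtoothRate.nonneg (steepness_nonneg hn) hε hε1) hr

/-- The bound does not depend on `ε`, so the jump widths can be chosen after the volume growth is
known. -/
lemma sawtooth_G_le {r : ℝ} (hr : 0 ≤ r) :
    (sawtooth n hn ε hε hε1).G (r ^ 2 / 2) ≤ 7 / 4 * r :=
  ofRate_G_le (sawtoothRate.contDiff hε) (fun _ hr => sawtoothRate.eq_zero hr)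
    (sawtoothRate.nonneg (steepness_nonneg hn) hε hε1)
    (sawtoothRate.le (steepness_nonneg hn) hε hε1) hr

lemma lt_bottomSpectrum_sawtooth :
    ((n : ℝ) - 1) ^ 2 / 4 < bottomSpectrum n ((sawtooth n hn ε hε hε1).Space n) := by
  have hn' : (2 : ℝ) ≤ n := by exact_mod_cast hn
  have hN := steepness_nonneg hn
  refine lt_of_lt_of_le ?_ ((sawtooth n hn ε hε hε1).le_bottomSpectrum (by omega)
    (5 / 8 * (n - 1)) (by linarith) fun t ht => ?_)
  · nlinarith
  have key : 5 / 4 * √(2 * t + 1 / 4) ≤ 1 + 2 * t * (sawtooth n hn ε hε hε1).C t := by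
    suffices √(2 * t + 1 / 4) ≤ 4 / 5 * (1 + 2 * t * (sawtooth n hn ε hε hε1).C t) by linarith
    rcases ht.eq_or_lt with rfl | ht
    · refine Real.sqrt_le_iff.2 ⟨?_, ?_⟩ <;> norm_num
    obtain ⟨r, hr, rfl⟩ : ∃ r : ℝ, 0 < r ∧ t = r ^ 2 / 2 :=
      ⟨√(2 * t), by positivity, by rw [Real.sq_sqrt (by positivity)]; ring⟩
    have h1 : 2 * (r ^ 2 / 2) * (sawtoothRate (32 * (n - 1)) ε r / r)
        = r * sawtoothRate (32 * (n - 1)) ε r := by field_simp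
    rw [sawtooth_C hn hε hε1 hr, h1]
    have h2 := sawtoothRate.nonneg hN hε hε1 r
    refine Real.sqrt_le_iff.2 ⟨by positivity, ?_⟩
    -- For `r ≤ 1/2` the rate may vanish, but `√(r² + 1/4) ≤ √(1/2) < 4/5`. Beyond, `K ≥ 5/4` makes
    -- the right side at least `r + 4/5`.
    rcases le_total r (1 / 2) with h | h
    · nlinarith [mul_nonneg hr.le h2]
    · have h3 := mul_le_mul_of_nonneg_left (sawtoothRate.ge hN hε hε1 h) hr.le
      nlinarith
  nlinarith

/-- The descending slope `-8(n-1)`, a quarter of `32(n-1)`, outweighs every other negative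
contribution to the Ricci curvature; only the derivative of the smooth floor can create a defect. -/
lemma ricciDefect_sawtooth_le {y : EuclideanSpace ℝ (Fin n)} (hy : 1 ≤ ‖y‖) {L : ℝ} (hL : 0 ≤ L)
    (h : 8 * (n - 1) ^ 2 * deriv (smoothFloor ε) (32 * (n - 1) * ‖y‖) ≤ L) :
    ricciDefect n ((sawtooth n hn ε hε hε1).toSpace y) ≤ L := by
  have hn' : (2 : ℝ) ≤ n := by exact_mod_cast hn
  have hN := steepness_nonneg hn
  have hy0 : 0 < ‖y‖ := by linarith
  have hK : sawtoothRate (32 * (n - 1)) ε ‖y‖ ≤ 7 / 4 := sawtoothRate.le hN hε hε1 _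
  have hK0 : 5 / 4 ≤ sawtoothRate (32 * (n - 1)) ε ‖y‖ :=
    sawtoothRate.ge hN hε hε1 (by linarith)
  have hC := sawtooth_C hn hε hε1 hy0
  have hX := sawtooth_radialCurv hn hε hε1 hy0
  have hd := sawtoothRate.deriv_eq (N := 32 * (n - 1)) hε (show 1 / 2 < ‖y‖ by linarith)
  set r := ‖y‖
  set k := sawtoothRate (32 * (n - 1)) ε r
  set d := deriv (sawtoothRate (32 * (n - 1)) ε) r
  have h1 : 2 * k / r ≤ 2 * k := div_le_self (by linarith) hy
  -- Here `105/16 = (7/4)² + 2 · (7/4)`; in `h3`, `121/16 = (1 + 7/4)²` bounds `(f'/f)²` for `r ≥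
  -- 1`.
  have h2 : d + k ^ 2 + 2 * k / r ≤ d + 105 / 16 := by nlinarith
  have h3 : (1 + r ^ 2 * (k / r)) ^ 2 ≤ r ^ 2 * (121 / 16) := by
    have : r ^ 2 * (k / r) = r * k := by field_simp
    rw [this]
    have h4 : 1 + r * k ≤ r * (11 / 4) := by nlinarith
    have h5 : 0 ≤ 1 + r * k := by nlinarith
    calc (1 + r * k) ^ 2 ≤ (r * (11 / 4)) ^ 2 := by gcongr
      _ = _ := by ring
  -- Both `105/16` and `121/16` are below `8`, so the zeroth-order terms are at most `8(n-1)`; the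
  -- excess `d + 8(n-1)` is controlled by `L`.
  have h6 : d + 105 / 16 + (n - 2) * (121 / 16) ≤ n - 1 + L ∧
      (n - 1) * (d + 105 / 16) ≤ n - 1 + L := by
    have h7 : (n - 1) * (d + 8 * (n - 1)) ≤ L := by
      refine le_trans (le_of_eq ?_) h
      rw [hd]
      ring
    rcases le_total (d + 8 * (n - 1)) 0 with h8 | h8
    · constructor <;> nlinarith
    · constructor <;> nlinarith
  refine ricciDefect_le_of_ne_zero _ hn y (norm_pos_iff.1 hy0) L hL ?_ ?_
  · rw [hX]
    refine le_trans ?_ h6.2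
    have : (0 : ℝ) ≤ n - 1 := by linarith
    gcongr
  · rw [hX, hC]
    have h7 := mul_le_mul_of_nonneg_left h3 (show (0 : ℝ) ≤ n - 2 by linarith)
    have h8 := mul_le_mul_of_nonneg_left h2 (sq_nonneg r)
    have h9 := mul_le_mul_of_nonneg_left h6.1 (sq_nonneg r)
    linarith

end

end RadialProfile

/-! ### Integrability of the powers of the Ricci defect -/

lemma volume_annulus_le {n : ℕ} (hn : 1 ≤ n) {a b : ℝ} (ha : 0 ≤ a) (hab : a ≤ b) :
    (volume : Measure (EuclideanSpace ℝ (Fin n))) {y | a ≤ ‖y‖ ∧ ‖y‖ ≤ b} ≤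
      ENNReal.ofReal (n * b ^ (n - 1) * (b - a))
        * volume (Metric.ball (0 : EuclideanSpace ℝ (Fin n)) 1) := by
  have hb := ha.trans hab
  have hsub : {y : EuclideanSpace ℝ (Fin n) | a ≤ ‖y‖ ∧ ‖y‖ ≤ b}
      ⊆ Metric.closedBall 0 b \ Metric.ball 0 a := fun y hy => by
    simpa using ⟨hy.2, hy.1⟩
  refine (measure_mono hsub).trans ?_
  have hpow : a ^ n ≤ b ^ n := by gcongr
  have hω : volume (Metric.ball (0 : EuclideanSpace ℝ (Fin n)) 1) ≠ ⊤ := measure_ball_lt_top.ne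
  rw [measure_sdiff ((Metric.ball_subset_ball hab).trans Metric.ball_subset_closedBall)
    measurableSet_ball.nullMeasurableSet measure_ball_lt_top.ne]
  have : Nonempty (Fin n) := ⟨⟨0, hn⟩⟩
  rw [Measure.addHaar_closedBall _ _ hb, Measure.addHaar_ball _ _ ha, finrank_euclideanSpace,
    Fintype.card_fin, ← ENNReal.sub_mul fun _ _ => hω, ← ENNReal.ofReal_sub _ (by positivity)]
  gcongr
  -- The bound `bⁿ - aⁿ ≤ n bⁿ⁻¹ (b - a)` makes the volume linear in the width.
  have := abs_pow_sub_pow_le b a n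
  rw [abs_of_nonneg (sub_nonneg.2 hpow), abs_of_nonneg (sub_nonneg.2 hab), abs_of_nonneg hb,
    abs_of_nonneg ha, max_eq_left hab] at this
  linarith

/-- Positive numbers at most `1` whose `p`-th powers decay against a given sequence. -/
lemma exists_rpow_mul_le (V : ℕ → ℝ) (hV : ∀ k, 0 ≤ V k) {p : ℝ} (hp : 0 < p) :
    ∃ ε : ℕ → ℝ, (∀ k, 0 < ε k) ∧ (∀ k, ε k ≤ 1) ∧ ∀ k, V k * ε k ^ p ≤ (1 / 2) ^ k := by
  have h1 : ∀ k, 0 < (1 / 2 : ℝ) ^ k / (V k + 1) := fun k => by have := hV k; positivity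
  refine ⟨fun k => ((1 / 2 : ℝ) ^ k / (V k + 1)) ^ p⁻¹, fun k => Real.rpow_pos_of_pos (h1 k) _,
    fun k => Real.rpow_le_one (h1 k).le ?_ (by positivity), fun k => ?_⟩
  · have := hV k
    rw [div_le_one (by positivity)]
    have : (1 / 2 : ℝ) ^ k ≤ 1 := pow_le_one₀ (by norm_num) (by norm_num)
    linarith
  · have := hV k
    rw [Real.rpow_inv_rpow (h1 k).le hp.ne', mul_div_assoc', div_le_iff₀ (by positivity), mul_comm]
    gcongr
    linarith

namespace RadialProfile

noncomputable section

open IntegralRicci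

variable {n : ℕ} (hn : 2 ≤ n) {ε : ℕ → ℝ} (hε : ∀ k, 0 < ε k) (hε1 : ∀ k, ε k ≤ 1)

lemma ricciDefect_nonneg (P : RadialProfile) (x : P.Space n) : 0 ≤ ricciDefect n x :=
  le_max_right _ _

/-- The `k`-th annulus on which the sawtooth rate jumps. -/
def jumpSet (n : ℕ) (ε : ℕ → ℝ) (k : ℕ) : Set (EuclideanSpace ℝ (Fin n)) :=
  {y | 1 ≤ ‖y‖ ∧ (k : ℝ) ≤ 32 * (n - 1) * ‖y‖ ∧ 32 * (n - 1) * ‖y‖ < k + ε k}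

lemma measurableSet_jumpSet (k : ℕ) : MeasurableSet (jumpSet n ε k) := by
  simp only [jumpSet, Set.ofPred_and]
  refine (measurableSet_le measurable_const measurable_norm).inter
    ((measurableSet_le measurable_const ?_).inter (measurableSet_lt ?_ measurable_const))
  all_goals exact measurable_norm.const_mul _

lemma volume_jumpSet_le (hn : 2 ≤ n) (hε : ∀ k, 0 < ε k) (hε1 : ∀ k, ε k ≤ 1) (k : ℕ) :
    (volume : Measure (EuclideanSpace ℝ (Fin n))) (jumpSet n ε k) ≤
      ENNReal.ofReal (n * (k + 1 : ℝ) ^ (n - 1) * ε k)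
        * volume (Metric.ball (0 : EuclideanSpace ℝ (Fin n)) 1) := by
  have hn' : (2 : ℝ) ≤ n := by exact_mod_cast hn
  have hN : (1 : ℝ) ≤ 32 * (n - 1) := by linarith
  have hN0 : (0 : ℝ) < 32 * (n - 1) := by linarith
  have hε' := hε k
  have hsub : jumpSet n ε k ⊆ {y | k / (32 * (n - 1)) ≤ ‖y‖ ∧ ‖y‖ ≤ (k + ε k) / (32 * (n - 1))} := by
    rintro y ⟨-, h1, h2⟩
    exact ⟨by rwa [div_le_iff₀' hN0], by rw [le_div_iff₀' hN0]; exact h2.le⟩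
  refine (measure_mono hsub).trans ((volume_annulus_le (by omega) (by positivity) (by gcongr; linarith)).trans ?_)
  have h1 : (k + ε k) / (32 * (n - 1)) ≤ k + 1 :=
    (div_le_self (by positivity) hN).trans (by linarith [hε1 k])
  have h2 : (k + ε k) / (32 * (n - 1)) - k / (32 * (n - 1)) ≤ ε k := by
    rw [← sub_div, add_sub_cancel_left]
    exact div_le_self hε'.le hN
  have h3 : 0 ≤ (k + ε k) / (32 * (n - 1)) - k / (32 * (n - 1)) := by
    rw [← sub_div, add_sub_cancel_left]
    positivity
  gcongr

lemma floor_of_mem_jumpSet (hε1 : ∀ k, ε k ≤ 1) {k : ℕ} {y : EuclideanSpace ℝ (Fin n)}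
    (hy : y ∈ jumpSet n ε k) : ⌊32 * (n - 1) * ‖y‖⌋₊ = k := by
  have h0 : (0 : ℝ) ≤ 32 * (n - 1) * ‖y‖ := le_trans k.cast_nonneg hy.2.1
  exact (Nat.floor_eq_iff h0).2 ⟨hy.2.1, hy.2.2.trans_le (by linarith [hε1 k])⟩

/-- Off the jumps the smooth floor is stationary, so `ricciDefect_sawtooth_le` applies with `L = 0`.
-/
lemma ricciDefect_sawtooth_eq_zero {y : EuclideanSpace ℝ (Fin n)} (hy : 1 < ‖y‖)
    (h : ∀ k, y ∉ jumpSet n ε k) :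
    ricciDefect n ((sawtooth n hn ε hε hε1).toSpace y) = 0 := by
  refine le_antisymm ?_ (ricciDefect_nonneg _ _)
  have hN := steepness_nonneg hn
  have h0 : (0 : ℝ) ≤ 32 * (n - 1) * ‖y‖ := by positivity
  refine ricciDefect_sawtooth_le hn hε hε1 hy.le le_rfl ?_
  rw [smoothFloor.deriv_eq hε hε1 h0, Real.smoothTransition.deriv_eq_zero_of_one_le]
  · simp
  · have h1 := h ⌊32 * (n - 1) * ‖y‖⌋₊
    rw [one_le_div (hε _)]
    by_contra! h2
    exact h1 ⟨hy.le, Nat.floor_le h0, by linarith⟩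

lemma ricciDefect_sawtooth_le_of_mem_jumpSet {M : ℝ} (hM0 : 0 ≤ M)
    (hM : ∀ x, deriv Real.smoothTransition x ≤ M) {k : ℕ} {y : EuclideanSpace ℝ (Fin n)}
    (hy : y ∈ jumpSet n ε k) :
    ricciDefect n ((sawtooth n hn ε hε hε1).toSpace y) ≤ 8 * (n - 1) ^ 2 * M / ε k := by
  have hN := steepness_nonneg hn
  have hε' := hε k
  have h0 : (0 : ℝ) ≤ 32 * (n - 1) * ‖y‖ := by positivity
  refine ricciDefect_sawtooth_le hn hε hε1 hy.1 (by positivity) ?_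
  rw [smoothFloor.deriv_eq hε hε1 h0, floor_of_mem_jumpSet hε1 hy, mul_div_assoc]
  gcongr
  exact hM _

lemma density_sawtooth_le {y : EuclideanSpace ℝ (Fin n)} {R : ℝ} (hy : ‖y‖ ≤ R) :
    (sawtooth n hn ε hε hε1).density n y ≤ Real.exp (2 * n * R) := by
  have hn' : (2 : ℝ) ≤ n := by exact_mod_cast hn
  have h1 := sawtooth_G_le hn hε hε1 (norm_nonneg y)
  have h0 := norm_nonneg y
  refine Real.exp_le_exp.2 ?_
  have h2 : (n - 1) * (sawtooth n hn ε hε hε1).G (‖y‖ ^ 2 / 2) ≤ n * (2 * R) := by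
    refine mul_le_mul (by linarith) (by linarith) ?_ (by linarith)
    exact (sawtooth n hn ε hε hε1).nonneg _
  linarith

lemma norm_le_of_mem_jumpSet (hn : 2 ≤ n) (hε1 : ∀ k, ε k ≤ 1) {k : ℕ}
    {y : EuclideanSpace ℝ (Fin n)} (hy : y ∈ jumpSet n ε k) : ‖y‖ ≤ k + 1 := by
  have hn' : (2 : ℝ) ≤ n := by exact_mod_cast hn
  have h1 : 1 * ‖y‖ ≤ 32 * (n - 1) * ‖y‖ := by
    gcongr
    linarith
  linarith [hy.2.2, hε1 k]

/-- For narrow enough jumps, the `s`-th power of the Ricci defect is integrable. -/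
lemma exists_lintegral_ricciDefect_lt_top (hn : 2 ≤ n) {s : ℝ} (hs0 : 0 < s) (hs1 : s < 1) :
    ∃ (ε : ℕ → ℝ) (hε : ∀ k, 0 < ε k) (hε1 : ∀ k, ε k ≤ 1),
      ∫⁻ x, ENNReal.ofReal (ricciDefect n x ^ s)
        ∂(riemannianVolume n ((sawtooth n hn ε hε hε1).Space n)) < ⊤ := by
  obtain ⟨M, hM0, hM⟩ := Real.smoothTransition.exists_deriv_le
  set W : ℝ := 8 * (n - 1) ^ 2 * M
  have hW : 0 ≤ W := by positivity
  -- The factors bound the density, the `ε`-free part of `w^s` and the area of the shell. The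
  -- exponent `1 - s` combines the width `ε k` with `(1 / ε k) ^ s`.
  obtain ⟨ε, hε, hε1, hV⟩ := exists_rpow_mul_le
    (fun k => Real.exp (2 * n * (k + 1)) * W ^ s * (n * (k + 1 : ℝ) ^ (n - 1)))
    (fun k => by positivity) (sub_pos.2 hs1)
  refine ⟨ε, hε, hε1, ?_⟩
  set P := sawtooth n hn ε hε hε1
  rw [P.lintegral_riemannianVolume (by omega)]
  set h : EuclideanSpace ℝ (Fin n) → ENNReal := fun y =>
    ENNReal.ofReal (P.density n y) * ENNReal.ofReal (ricciDefect n (P.toSpace y) ^ s)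
  set vol₁ := volume (Metric.ball (0 : EuclideanSpace ℝ (Fin n)) 1)
  have hvol : vol₁ ≠ ⊤ := measure_ball_lt_top.ne
  -- The defect vanishes outside `U`: the unit ball contributes a finite amount by compactness, and
  -- the jump shells are summed by a geometric series.
  set U : Set (EuclideanSpace ℝ (Fin n)) := Metric.closedBall 0 1 ∪ ⋃ k, jumpSet n ε k
  have hU : MeasurableSet U :=
    measurableSet_closedBall.union (MeasurableSet.iUnion fun k => measurableSet_jumpSet k)
  have hsupp : ∫⁻ y, h y = ∫⁻ y in U, h y := by
    rw [← lintegral_indicator hU]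
    congr 1
    funext y
    by_cases hy : y ∈ U
    · rw [Set.indicator_of_mem hy]
    · rw [Set.indicator_of_notMem hy]
      simp only [U, Set.mem_union, Metric.mem_closedBall, dist_zero_right, Set.mem_iUnion,
        not_or, not_le, not_exists] at hy
      simp only [h]
      rw [ricciDefect_sawtooth_eq_zero hn hε hε1 hy.1 hy.2, Real.zero_rpow hs0.ne']
      simp
  have hball : ∫⁻ y in Metric.closedBall 0 1, h y < ⊤ := by
    obtain ⟨L, hL⟩ := P.exists_ricciDefect_le (show 1 ≤ n by omega) 1
    refine lt_of_le_of_lt (setLIntegral_mono' (g := fun _ =>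
      ENNReal.ofReal (Real.exp (2 * n * 1)) * ENNReal.ofReal (L ^ s))
      measurableSet_closedBall fun y hy => ?_) ?_
    · have hy : ‖y‖ ≤ 1 := by simpa using hy
      have h1 := ricciDefect_nonneg P (P.toSpace y)
      simp only [h]
      gcongr
      · exact density_sawtooth_le hn hε hε1 hy
      · exact hL y hy
    · rw [setLIntegral_const]
      exact ENNReal.mul_lt_top (ENNReal.mul_lt_top ENNReal.ofReal_lt_top ENNReal.ofReal_lt_top)
        measure_closedBall_lt_top
  have hjump : ∀ k, ∫⁻ y in jumpSet n ε k, h y ≤ ENNReal.ofReal ((1 / 2) ^ k) * vol₁ := by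
    intro k
    have hεk := hε k
    refine (setLIntegral_mono' (g := fun _ =>
      ENNReal.ofReal (Real.exp (2 * n * (k + 1))) * ENNReal.ofReal ((W / ε k) ^ s))
      (measurableSet_jumpSet k) fun y hy => ?_).trans ?_
    · have h1 := ricciDefect_nonneg P (P.toSpace y)
      simp only [h]
      gcongr
      · exact density_sawtooth_le hn hε hε1 (norm_le_of_mem_jumpSet hn hε1 hy)
      · exact ricciDefect_sawtooth_le_of_mem_jumpSet hn hε hε1 hM0 hM hy
    · rw [setLIntegral_const]
      refine (mul_le_mul_right (volume_jumpSet_le hn hε hε1 k) _).trans ?_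
      rw [← mul_assoc, ← ENNReal.ofReal_mul (by positivity), ← ENNReal.ofReal_mul (by positivity)]
      gcongr
      refine le_trans (le_of_eq ?_) (hV k)
      rw [Real.div_rpow hW hεk.le, Real.rpow_sub hεk, Real.rpow_one]
      field_simp
  rw [hsupp]
  refine (lintegral_union_le _ _ _).trans_lt (ENNReal.add_lt_top.2 ⟨hball, ?_⟩)
  refine (lintegral_iUnion_le _ _).trans_lt ((ENNReal.tsum_le_tsum hjump).trans_lt ?_)
  rw [ENNReal.tsum_mul_right, ← ENNReal.ofReal_tsum_of_nonneg (fun k => by positivity)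
    (summable_geometric_of_lt_one (by norm_num) (by norm_num))]
  exact ENNReal.mul_lt_top ENNReal.ofReal_lt_top hvol.lt_top

end

end RadialProfile

theorem theorem3p1 (n : ℕ) (hn : 2 ≤ n) (s : ℝ) (hs0 : 0 < s) (hs : s < 1 / 2) :
    ∃ (M : Type) (_ : EMetricSpace M) (_ : ChartedSpace (EuclideanSpace ℝ (Fin n)) M)
      (_ : IsManifold (𝓡 n) ∞ M)
      (_ : RiemannianBundle (fun x : M => TangentSpace (𝓡 n) x))
      (_ : IsContMDiffRiemannianBundle (𝓡 n) ∞ (EuclideanSpace ℝ (Fin n))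
        (fun x : M => TangentSpace (𝓡 n) x))
      (_ : IsRiemannianManifold (𝓡 n) M)
      (_ : MeasurableSpace M) (_ : BorelSpace M),
      ConnectedSpace M ∧ SecondCountableTopology M ∧ CompleteSpace M ∧
      (∫⁻ x : M, ENNReal.ofReal (IntegralRicci.ricciDefect n x ^ s)
        ∂(IntegralRicci.riemannianVolume n M)) < ⊤ ∧
      ((n : ℝ) - 1) ^ 2 / 4 < IntegralRicci.bottomSpectrum n M := by
  obtain ⟨ε, hε, hε1, h⟩ :=
    RadialProfile.exists_lintegral_ricciDefect_lt_top hn hs0 (by linarith : s < 1)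
  exact ⟨(RadialProfile.sawtooth n hn ε hε hε1).Space n, inferInstance, inferInstance,
    inferInstance, inferInstance, inferInstance, inferInstance, inferInstance, inferInstance,
    inferInstance, inferInstance, inferInstance, h,
    RadialProfile.lt_bottomSpectrum_sawtooth hn hε hε1⟩
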